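/- Let $\mathbb S^2\subset\mathbb R^3$ be the unit sphere, $d\sigma_\eta$ its surface measure, $\cdot$ and $\times$ the scalar and wedge products of $\mathbb R^3$, and $\nabla f(\eta)\in\mathbb R^3$ (orthogonal to $\eta$) the Riemannian gradient of a scalar field $f$ on $\mathbb S^2$. A subscript $b$ in $C^1_b$ means that the function and its first derivatives are bounded. Fix $T>0$, gains and weights $k_y,k_D,\lambda_y,\lambda_D>0$, and constant biases $p_v,p_\omega\in\mathbb R^3$. *Data.* Call $(v,\omega,y,D)$ admissible data if $v,\omega\in C^1_b([0,\infty),\mathbb R^3)$, $y,D\in C^1_b([0,\infty)\times\mathbb S^2,\mathbb R)$, $D\ge D_*$ on $[0,\infty)\times\mathbb S^2$ for some constant $D_*>0$, and, with the measured velocities $v_m=v+p_v$, $\omega_m=\omega+p_\omega$, for all $(t,\eta)\in[0,\infty)\times\mathbb S^2$ $$\partial_t y=-\nabla y\cdot\Big(\eta\times\big(\omega_m-p_\omega+\tfrac1D\,\eta\times(v_m-p_v)\big)\Big),$$ $$\partial_t D=-\nabla D\cdot\Big(\eta\times\big(\omega_m-p_\omega+\tfrac1D\,\eta\times(v_m-p_v)\big)\Big)-\eta\cdot(v_m-p_v).$$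 *Observer.* An observer solution associated with such data is a quadruple $(\hat y,\hat D,\hat p_\omega,\hat p_v)\in C^1([0,\infty)\times\mathbb S^2,\mathbb R)^2\times C^1([0,\infty),\mathbb R^3)^2$ such that, on $[0,\infty)$ and for all $\eta\in\mathbb S^2$, $$\partial_t\hat y=-\nabla\hat y\cdot\Big(\eta\times\big(\omega_m-\hat p_\omega+\tfrac1D\,\eta\times(v_m-\hat p_v)\big)\Big)+k_y(y-\hat y),$$ $$\partial_t\hat D=-\nabla\hat D\cdot\Big(\eta\times\big(\omega_m-\hat p_\omega+\tfrac1D\,\eta\times(v_m-\hat p_v)\big)\Big)-(v_m-\hat p_v)\cdot\eta+k_D(D-\hat D),$$ $$\frac{d\hat p_\omega}{dt}=-\int_{\mathbb S^2}\Big(\lambda_y(\hat y-y)(\nabla\hat y\times\eta)+\lambda_D(\hat D-D)(\nabla\hat D\times\eta)\Big)d\sigma_\eta,$$ $$\frac{d\hat p_v}{dt}=-\int_{\mathbb S^2}\Big(\lambda_D(\hat D-D)\eta+\lambda_y(\hat y-y)\tfrac1D\,\eta\times(\eta\times\nabla\hat y)+\lambda_D(\hat D-D)\tfrac1D\,\eta\times(\eta\times\nabla\hat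 D)\Big)d\sigma_\eta,$$ with $\hat y(0,\cdot)=y(0,\cdot)$ and $\hat D(0,\cdot)=D(0,\cdot)$. *Statement.* Let $(v^n,\omega^n,y^n,D^n)$, $n\in\mathbb N$, and $(v,\omega,y,D)$ be admissible data (for the same biases $p_v,p_\omega$) such that, as $n\to\infty$, 1. $(v^n,\omega^n)\to(v,\omega)$ in $C^0([0,T],\mathbb R^3)^2$; 2. $(y^n,D^n)_{n}$ is bounded in $C^1([0,T]\times\mathbb S^2,\mathbb R)^2$; 3. $(y^n,D^n)\to(y,D)$ in $C^0([0,T]\times\mathbb S^2,\mathbb R)^2$. Let $(\hat y^n,\hat D^n,\hat p_\omega^n,\hat p_v^n)$ and $(\hat y,\hat D,\hat p_\omega,\hat p_v)$ be observer solutions associated with these data, such that $(\hat p_\omega^n,\hat p_v^n)(0)\to(\hat p_\omega,\hat p_v)(0)$. Then $$(\hat p_\omega^n,\hat p_v^n)\to(\hat p_\omega,\hat p_v)\ \text{ in } C^0([0,T],\mathbb R^3)^2,\qquad (\hat y^n,\hat D^n)\to(\hat y,\hat D)\ \text{ in } C^0([0,T]\times\mathbb S^2,\mathbb R)^2 .$$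 -/

import Mathlib

open Set Filter Topology MeasureTheory
open scoped Manifold ContDiff

noncomputable section

namespace BiasObserver

/-- Euclidean space `ℝ³`. -/
abbrev E3 : Type := EuclideanSpace ℝ (Fin 3)

/-- The unit sphere of `ℝ³`, with the manifold structure, topology and Borel structure that
Mathlib puts on it. -/
abbrev S2 : Type := Metric.sphere (0 : E3) 1

/-- The wedge (cross) product of two vectors of `ℝ³`. -/
def cross (a b : E3) : E3 :=
  WithLp.toLp 2 (crossProduct (WithLp.ofLp a) (WithLp.ofLp b))

/-- The scalar product of two vectors of `ℝ³`. -/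
def dot (a b : E3) : ℝ := inner ℝ a b

/-- The radial projection `x ↦ x / ‖x‖` of `ℝ³ \ {0}` onto the sphere (with an irrelevant value at
the origin). -/
def radialProj (x : E3) : S2 :=
  if h : x = 0 then ⟨EuclideanSpace.single 0 1, by simp⟩
  else ⟨‖x‖⁻¹ • x, by simp [norm_smul, h]⟩

/-- The Riemannian gradient at `η` of a scalar field `f` on the sphere, as a vector of `ℝ³`: the
Euclidean gradient at `η` of the extension `x ↦ f (x / ‖x‖)`, which is constant along rays.  It is
orthogonal to `η`, and its scalar product with a tangent vector is the derivative of `f` along that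
vector: see `dot_sphereGrad_self` and `dot_sphereGrad_mfderiv`. -/
def sphereGrad (f : S2 → ℝ) (η : S2) : E3 :=
  gradient (fun x : E3 => f (radialProj x)) (η : E3)

theorem radialProj_coe (η : S2) : radialProj (η : E3) = η := by
  have h1 : ‖(η : E3)‖ = 1 := by simp
  have h : (η : E3) ≠ 0 := by
    intro h0
    simp [h0] at h1
  ext1
  simp [radialProj, h, h1]

theorem contMDiffAt_radialProj {x : E3} (hx : x ≠ 0) :
    ContMDiffAt 𝓘(ℝ, E3) (𝓡 2) 1 radialProj x := by
  let U : TopologicalSpace.Opens E3 := ⟨{0}ᶜ, isOpen_compl_singleton⟩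
  have hU : ∀ z : U, (z : E3) ≠ 0 := fun z => z.2
  have hsm : ContMDiff 𝓘(ℝ, E3) 𝓘(ℝ, E3) 1 (fun z : U => ‖(z : E3)‖⁻¹ • (z : E3)) := by
    intro z
    refine (contMDiffAt_subtype_iff (f := fun x : E3 => ‖x‖⁻¹ • x)).2 (ContDiffAt.contMDiffAt ?_)
    exact ((contDiffAt_norm ℝ (hU z)).inv (norm_ne_zero_iff.2 (hU z))).smul contDiffAt_id
  have hmem : ∀ z : U, ‖(z : E3)‖⁻¹ • (z : E3) ∈ Metric.sphere (0 : E3) 1 := fun z => by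
    simp [norm_smul, hU z]
  have hfact : Fact (Module.finrank ℝ E3 = 2 + 1) := ⟨by simp⟩
  have hc := ContMDiff.codRestrict_sphere (n := 2) hsm hmem
  have he : (fun z : U => radialProj (z : E3)) = Set.codRestrict _ _ hmem := by
    funext z
    ext1
    simp [radialProj, hU z]
  refine (contMDiffAt_subtype_iff (U := U) (f := radialProj) (x := ⟨x, hx⟩)).1 ?_
  rw [he]
  exact hc ⟨x, hx⟩

theorem differentiableAt_comp_radialProj {f : S2 → ℝ} {η : S2}
    (hf : MDifferentiableAt (𝓡 2) 𝓘(ℝ, ℝ) f η) :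
    DifferentiableAt ℝ (fun x : E3 => f (radialProj x)) (η : E3) := by
  have h0 : (η : E3) ≠ 0 := ne_zero_of_mem_unit_sphere η
  rw [← mdifferentiableAt_iff_differentiableAt]
  have hr : MDifferentiableAt 𝓘(ℝ, E3) (𝓡 2) radialProj (η : E3) :=
    (contMDiffAt_radialProj h0).mdifferentiableAt (by simp)
  exact MDifferentiableAt.comp (η : E3) (g := f) (by rwa [radialProj_coe]) hr

/-- The gradient is tangent to the sphere. -/
theorem dot_sphereGrad_self (f : S2 → ℝ) (η : S2) : dot (sphereGrad f η) η = 0 := by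
  have h0 : (η : E3) ≠ 0 := ne_zero_of_mem_unit_sphere η
  by_cases hd : DifferentiableAt ℝ (fun x : E3 => f (radialProj x)) (η : E3)
  · have hl : HasDerivAt (fun s : ℝ => s • (η : E3)) (η : E3) 1 := by
      simpa using (hasDerivAt_id (1 : ℝ)).smul_const (η : E3)
    have hc : HasDerivAt (fun s : ℝ => f (radialProj (s • (η : E3))))
        (fderiv ℝ (fun x : E3 => f (radialProj x)) (η : E3) η) 1 := by
      have hd' : HasFDerivAt (fun x : E3 => f (radialProj x))
          (fderiv ℝ (fun x : E3 => f (radialProj x)) (η : E3)) ((1 : ℝ) • (η : E3)) := by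
        rw [one_smul]; exact hd.hasFDerivAt
      exact hd'.comp_hasDerivAt (1 : ℝ) hl
    have hk : (fun s : ℝ => f (radialProj (s • (η : E3)))) =ᶠ[𝓝 1] fun _ => f η := by
      filter_upwards [lt_mem_nhds (zero_lt_one' ℝ)] with s hs
      congr 1
      ext1
      have h1 : ‖(η : E3)‖ = 1 := by simp
      simp [radialProj, h0, hs.ne', norm_smul, abs_of_pos hs, h1, smul_smul]
    have := hc.unique ((hasDerivAt_const (1 : ℝ) (f η)).congr_of_eventuallyEq hk)
    rw [dot, sphereGrad, gradient, InnerProductSpace.toDual_symm_apply, this]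
  · rw [sphereGrad, gradient_eq_zero_of_not_differentiableAt hd, dot, inner_zero_left]

/-- The scalar product of the gradient with a tangent vector is the derivative of the field along
that vector. -/
theorem dot_sphereGrad_mfderiv {f : S2 → ℝ} {η : S2}
    (hf : MDifferentiableAt (𝓡 2) 𝓘(ℝ, ℝ) f η) (u : TangentSpace (𝓡 2) η) :
    dot (sphereGrad f η) (mfderiv (𝓡 2) 𝓘(ℝ, E3) (fun ξ : S2 => (ξ : E3)) η u) =
      mfderiv (𝓡 2) 𝓘(ℝ, ℝ) f η u := by
  have hfact : Fact (Module.finrank ℝ E3 = 2 + 1) := ⟨by simp⟩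
  have hd := (differentiableAt_comp_radialProj hf).mdifferentiableAt
  have hi : MDifferentiableAt (𝓡 2) 𝓘(ℝ, E3) (fun ξ : S2 => (ξ : E3)) η :=
    (contMDiff_coe_sphere (n := 2) (m := 1) η).mdifferentiableAt (by simp)
  have he : f = (fun x : E3 => f (radialProj x)) ∘ fun ξ : S2 => (ξ : E3) := by
    funext ξ
    simp [radialProj_coe]
  have hc := mfderiv_comp (I' := 𝓘(ℝ, E3)) η hd hi
  rw [← he, mfderiv_eq_fderiv] at hc
  rw [hc]
  exact InnerProductSpace.toDual_symm_apply

/-- The surface measure of the unit sphere. -/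
def sphereMeasure : Measure S2 := (volume : Measure E3).toSphere

/-- `f ∈ C¹([0,∞) × S², ℝ)`.  (Fields are functions of all real times; only their values for
nonnegative times are ever used.) -/
def FieldC1 (f : ℝ → S2 → ℝ) : Prop :=
  ContMDiffOn (𝓘(ℝ, ℝ).prod (𝓡 2)) 𝓘(ℝ, ℝ) 1 (fun p : ℝ × S2 => f p.1 p.2)
    (Ici (0 : ℝ) ×ˢ (univ : Set S2))

/-- The time derivative on `[0,∞)` of a field (one-sided at time `0`). -/
def fieldDt (f : ℝ → S2 → ℝ) (t : ℝ) (η : S2) : ℝ :=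
  derivWithin (fun s => f s η) (Ici 0) t

/-- `f`, `∂ₜ f` and `∇ f` are bounded by `M` on `J × S²`. -/
def FieldC1Bound (f : ℝ → S2 → ℝ) (J : Set ℝ) (M : ℝ) : Prop :=
  ∀ t ∈ J, ∀ η : S2, |f t η| ≤ M ∧ |fieldDt f t η| ≤ M ∧ ‖sphereGrad (f t) η‖ ≤ M

/-- `f ∈ C¹_b([0,∞) × S², ℝ)`. -/
def FieldC1b (f : ℝ → S2 → ℝ) : Prop :=
  FieldC1 f ∧ ∃ M : ℝ, FieldC1Bound f (Ici 0) M

/-- `u ∈ C¹_b([0,∞), ℝ³)`. -/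
def VelC1b (u : ℝ → E3) : Prop :=
  ContDiffOn ℝ 1 u (Ici 0) ∧ ∃ M : ℝ, ∀ t ∈ Ici (0 : ℝ), ‖u t‖ ≤ M ∧ ‖derivWithin u (Ici 0) t‖ ≤ M

/-- The vector field `η × (w + (1/D) η × v)` at the point `η`. -/
def flowField (w v : E3) (D : ℝ) (η : S2) : E3 :=
  cross η (w + (1 / D) • cross η v)

/-- The brightness and depth fields `(y, D)` satisfy the state equations on `[0,∞)` for the
measured velocities `vm`, `wm` and the constant biases `pv`, `pw`. -/
structure IsStateSolution (vm wm : ℝ → E3) (pv pw : E3) (y D : ℝ → S2 → ℝ) : Prop where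
  eq_y : ∀ t ∈ Ici (0 : ℝ), ∀ η : S2,
    HasDerivWithinAt (fun s => y s η)
      (-dot (sphereGrad (y t) η) (flowField (wm t - pw) (vm t - pv) (D t η) η))
      (Ici 0) t
  eq_D : ∀ t ∈ Ici (0 : ℝ), ∀ η : S2,
    HasDerivWithinAt (fun s => D s η)
      (-dot (sphereGrad (D t) η) (flowField (wm t - pw) (vm t - pv) (D t η) η)
        - dot η (vm t - pv))
      (Ici 0) t

/-- `(yh, Dh, pwh, pvh) ∈ C¹([0,∞) × S²)² × C¹([0,∞), ℝ³)²` is a solution on `[0,∞)` of the observer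
with gains `ky`, `kD`, weights `ly`, `lD`, measured velocities `vm`, `wm` and measured fields
`y`, `D`, started from the measured fields: `yh(0) = y(0)` and `Dh(0) = D(0)`. -/
structure IsObserverSolution (ky kD ly lD : ℝ) (vm wm : ℝ → E3) (y D : ℝ → S2 → ℝ)
    (yh Dh : ℝ → S2 → ℝ) (pwh pvh : ℝ → E3) : Prop where
  yh_C1 : FieldC1 yh
  Dh_C1 : FieldC1 Dh
  pwh_C1 : ContDiffOn ℝ 1 pwh (Ici 0)
  pvh_C1 : ContDiffOn ℝ 1 pvh (Ici 0)
  eq_yh : ∀ t ∈ Ici (0 : ℝ), ∀ η : S2,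
    HasDerivWithinAt (fun s => yh s η)
      (-dot (sphereGrad (yh t) η) (flowField (wm t - pwh t) (vm t - pvh t) (D t η) η)
        + ky * (y t η - yh t η))
      (Ici 0) t
  eq_Dh : ∀ t ∈ Ici (0 : ℝ), ∀ η : S2,
    HasDerivWithinAt (fun s => Dh s η)
      (-dot (sphereGrad (Dh t) η) (flowField (wm t - pwh t) (vm t - pvh t) (D t η) η)
        - dot (vm t - pvh t) η + kD * (D t η - Dh t η))
      (Ici 0) t
  eq_pwh : ∀ t ∈ Ici (0 : ℝ),
    HasDerivWithinAt pwh
      (-∫ η : S2,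
          ((ly * (yh t η - y t η)) • cross (sphereGrad (yh t) η) η
            + (lD * (Dh t η - D t η)) • cross (sphereGrad (Dh t) η) η)
        ∂sphereMeasure)
      (Ici 0) t
  eq_pvh : ∀ t ∈ Ici (0 : ℝ),
    HasDerivWithinAt pvh
      (-∫ η : S2,
          ((lD * (Dh t η - D t η)) • (η : E3)
            + (ly * (yh t η - y t η)) •
                ((1 / D t η) • cross η (cross η (sphereGrad (yh t) η)))
            + (lD * (Dh t η - D t η)) •
                ((1 / D t η) • cross η (cross η (sphereGrad (Dh t) η))))
        ∂sphereMeasure)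
      (Ici 0) t
  init_yh : ∀ η : S2, yh 0 η = y 0 η
  init_Dh : ∀ η : S2, Dh 0 η = D 0 η

/-- Uniform convergence on `[0,T]`, i.e. convergence in `C⁰([0,T], ℝ³)`. -/
def TendstoC0Vec (T : ℝ) (u : ℕ → ℝ → E3) (u' : ℝ → E3) : Prop :=
  TendstoUniformlyOn u u' atTop (Icc 0 T)

/-- Uniform convergence on `[0,T] × S²`, i.e. convergence in `C⁰([0,T] × S², ℝ)`. -/
def TendstoC0Field (T : ℝ) (f : ℕ → ℝ → S2 → ℝ) (f' : ℝ → S2 → ℝ) : Prop :=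
  TendstoUniformlyOn (fun n (p : ℝ × S2) => f n p.1 p.2) (fun p : ℝ × S2 => f' p.1 p.2) atTop
    (Icc (0 : ℝ) T ×ˢ (univ : Set S2))

/-- `(v, w, y, D)` are admissible data: `v, w ∈ C¹_b([0,∞), ℝ³)`, `y, D ∈ C¹_b([0,∞) × S², ℝ)`, `D` is
bounded below by a positive constant, and `(y, D)` solves the state equations with measured
velocities `v + pv`, `w + pw`. -/
structure IsData (pv pw : E3) (v w : ℝ → E3) (y D : ℝ → S2 → ℝ) : Prop where
  v_C1b : VelC1b v
  w_C1b : VelC1b w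
  y_C1b : FieldC1b y
  D_C1b : FieldC1b D
  D_pos : ∃ Dmin : ℝ, 0 < Dmin ∧ ∀ t ∈ Ici (0 : ℝ), ∀ η : S2, Dmin ≤ D t η
  state : IsStateSolution (fun t => v t + pv) (fun t => w t + pw) pv pw y D

end BiasObserver

end

noncomputable section

namespace BiasObserver

/-! ### Fields of class `C¹` on the sphere -/

/-! The difficulty is that nothing bounds the gradients of the perturbed estimates `ŷⁿ`, `D̂ⁿ`
uniformly in `n`. Only two families of gradients are under control on `[0,T]`: those of the data
`yⁿ`, `Dⁿ`, by hypothesis, and those of the limit estimates `ŷ`, `D̂`, by compactness. The proof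
compares the two observers without ever measuring `∇ŷⁿ` or `∇D̂ⁿ`, by two devices.

For the fields, a maximum principle: where `|ŷⁿ - ŷ|` is maximal on the sphere, `∇ŷⁿ = ∇ŷ`. The
difference of the transport terms there is `∇ŷ` against the difference of the two flows, which is
controlled by the data and the biases, while the gain term is damping up to the error on the data
(`exists_sign_of_first_contact`).

For the biases, integration by parts: with `f' = ŷⁿ`, `g' = yⁿ`, `f = ŷ`, `g = y` and weights `a'`,
`a`, the difference `a'(f' - g')∇f' - a(f - g)∇f` equals `½∇q` plus a small remainder containing
only `∇f`, `∇g'` and `∇a'`, where `q = a'((f' - g')² - (f - g')²)` is itself small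
(`CloseFields.exists_sphereGrad_approx`). Since `∫∇q = ∫2qη` and `∫∇q × η = 0`, the bias rates are
Lipschitz for the sup norm, at distances at most `1`.

These bounds close up in one barrier argument, `IsObserverSolution.dist_lt`: the largest of the four
differences stays below `δ exp(Kt)`, because at a first contact its derivative would have to be at
least `K` times the barrier, whereas the estimates make it strictly smaller. As `K` depends only on
uniform bounds, `δ` can be taken as small as desired when `n` is large. -/

theorem finrank_E3 : Module.finrank ℝ E3 = 3 := by simp

theorem norm_coe_S2 (η : S2) : ‖(η : E3)‖ = 1 := by simp

theorem coe_S2_ne_zero (η : S2) : (η : E3) ≠ 0 := ne_zero_of_mem_unit_sphere η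

theorem radialProj_smul {c : ℝ} (hc : 0 < c) (x : E3) : radialProj (c • x) = radialProj x := by
  by_cases hx : x = 0
  · simp [hx]
  · have h : c • x ≠ 0 := smul_ne_zero hc.ne' hx
    ext1
    simp only [radialProj, hx, h, dif_neg, not_false_eq_true, norm_smul, Real.norm_eq_abs,
      abs_of_pos hc, smul_smul]
    congr 1
    field_simp

theorem coe_radialProj {x : E3} (hx : x ≠ 0) : (radialProj x : E3) = ‖x‖⁻¹ • x := by
  simp [radialProj, hx]

/-- A scalar field on the sphere is of class `C¹` if its extension by constants along rays is. -/
def SphereC1 (f : S2 → ℝ) : Prop :=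
  ContDiffOn ℝ 1 (fun x : E3 => f (radialProj x)) {0}ᶜ

theorem SphereC1.contDiffAt {f : S2 → ℝ} (hf : SphereC1 f) {x : E3} (hx : x ≠ 0) :
    ContDiffAt ℝ 1 (fun x : E3 => f (radialProj x)) x :=
  ContDiffOn.contDiffAt hf (isOpen_compl_singleton.mem_nhds hx)

theorem SphereC1.differentiableAt {f : S2 → ℝ} (hf : SphereC1 f) (η : S2) :
    DifferentiableAt ℝ (fun x : E3 => f (radialProj x)) (η : E3) :=
  (hf.contDiffAt (coe_S2_ne_zero η)).differentiableAt (by simp)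

theorem SphereC1.continuous {f : S2 → ℝ} (hf : SphereC1 f) : Continuous f := by
  have h : Continuous fun η : S2 => f (radialProj (η : E3)) :=
    ContinuousOn.comp_continuous (g := fun x : E3 => f (radialProj x))
      (ContDiffOn.continuousOn hf) continuous_subtype_val coe_S2_ne_zero
  simpa only [radialProj_coe] using h

theorem SphereC1.sub {f g : S2 → ℝ} (hf : SphereC1 f) (hg : SphereC1 g) :
    SphereC1 (fun η => f η - g η) := ContDiffOn.sub hf hg

theorem SphereC1.mul {f g : S2 → ℝ} (hf : SphereC1 f) (hg : SphereC1 g) :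
    SphereC1 (fun η => f η * g η) := ContDiffOn.mul hf hg

theorem SphereC1.inv {f : S2 → ℝ} (hf : SphereC1 f) (h0 : ∀ η, f η ≠ 0) :
    SphereC1 (fun η => (f η)⁻¹) := ContDiffOn.inv hf fun _ _ => h0 _

theorem sphereC1_const (c : ℝ) : SphereC1 fun _ => c := contDiffOn_const

theorem sphereC1_inner (e : E3) : SphereC1 fun η : S2 => inner ℝ e (η : E3) := by
  have h : ContDiffOn ℝ 1 (fun x : E3 => inner ℝ e (‖x‖⁻¹ • x)) {0}ᶜ := by
    intro x hx
    refine ContDiffAt.contDiffWithinAt (ContDiffAt.inner ℝ contDiffAt_const ?_)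
    exact ((contDiffAt_norm ℝ hx).inv (norm_ne_zero_iff.2 hx)).smul contDiffAt_id
  exact h.congr fun x hx => by simp only [coe_radialProj hx]

/-- `g` is the gradient at `η` of the scalar field `f`. -/
def HasSphereGrad (f : S2 → ℝ) (g : E3) (η : S2) : Prop :=
  HasGradientAt (fun x : E3 => f (radialProj x)) g (η : E3)

theorem SphereC1.hasSphereGrad {f : S2 → ℝ} (hf : SphereC1 f) (η : S2) :
    HasSphereGrad f (sphereGrad f η) η := (hf.differentiableAt η).hasGradientAt

theorem HasSphereGrad.sphereGrad_eq {f : S2 → ℝ} {g : E3} {η : S2} (h : HasSphereGrad f g η) :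
    sphereGrad f η = g := HasGradientAt.gradient h

theorem HasSphereGrad.sub {f f' : S2 → ℝ} {g g' : E3} {η : S2} (h : HasSphereGrad f g η)
    (h' : HasSphereGrad f' g' η) : HasSphereGrad (fun ξ => f ξ - f' ξ) (g - g') η := by
  unfold HasSphereGrad at *
  rw [hasGradientAt_iff_hasFDerivAt] at *
  rw [map_sub]
  exact h.sub h'

theorem HasSphereGrad.mul {f f' : S2 → ℝ} {g g' : E3} {η : S2} (h : HasSphereGrad f g η)
    (h' : HasSphereGrad f' g' η) :
    HasSphereGrad (fun ξ => f ξ * f' ξ) (f η • g' + f' η • g) η := by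
  unfold HasSphereGrad at *
  rw [hasGradientAt_iff_hasFDerivAt] at *
  have := h.mul h'
  simp only [radialProj_coe] at this
  rw [map_add, map_smul, map_smul]
  exact this

theorem HasSphereGrad.inv {f : S2 → ℝ} {g : E3} {η : S2} (h : HasSphereGrad f g η)
    (h0 : f η ≠ 0) : HasSphereGrad (fun ξ => (f ξ)⁻¹) (-((f η ^ 2)⁻¹ • g)) η := by
  unfold HasSphereGrad at *
  rw [hasGradientAt_iff_hasFDerivAt] at *
  have h1 : f (radialProj (η : E3)) ≠ 0 := by rwa [radialProj_coe]
  have := (hasDerivAt_inv h1).comp_hasFDerivAt (η : E3) h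
  simpa [radialProj_coe, Function.comp_def] using this

/-! ### Derivatives of radial extensions away from the unit sphere -/

theorem dot_sphereGrad_eq_fderiv (f : S2 → ℝ) (η : S2) (e : E3) :
    dot (sphereGrad f η) e = fderiv ℝ (fun x : E3 => f (radialProj x)) (η : E3) e := by
  rw [dot, sphereGrad, gradient, InnerProductSpace.toDual_symm_apply]

/-- The extension is homogeneous of degree `0`, so its derivative is homogeneous of degree `-1`. -/
theorem fderiv_comp_radialProj (f : S2 → ℝ) {x : E3} (hx : x ≠ 0) (e : E3) :
    fderiv ℝ (fun x : E3 => f (radialProj x)) x e =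
      ‖x‖⁻¹ * dot (sphereGrad f (radialProj x)) e := by
  have hc : 0 < ‖x‖⁻¹ := inv_pos.2 (norm_pos_iff.2 hx)
  have h : (fun x : E3 => f (radialProj x)) = fun x : E3 => f (radialProj (‖x‖⁻¹ • x)) := by
    funext z
    by_cases hz : z = 0
    · simp [hz]
    · rw [radialProj_smul (inv_pos.2 (norm_pos_iff.2 hz))]
  have h2 := fderiv_comp_smul (𝕜 := ℝ) (f := fun x : E3 => f (radialProj x)) (x := x) ‖x‖⁻¹
  have h3 : (fun z : E3 => f (radialProj (‖x‖⁻¹ • z))) = fun x : E3 => f (radialProj x) := by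
    funext z
    rw [radialProj_smul hc]
  rw [h3] at h2
  rw [h2, dot_sphereGrad_eq_fderiv, coe_radialProj hx]
  simp

theorem fderiv_norm_apply {x : E3} (hx : x ≠ 0) (e : E3) :
    fderiv ℝ (fun x : E3 => ‖x‖) x e = dot (radialProj x) e := by
  -- The derivative of `‖x‖²` is computed in two ways and the results are compared.
  have hsq := (hasStrictFDerivAt_norm_sq x).hasFDerivAt
  have hs2 := ((contDiffAt_norm ℝ hx (n := 1)).differentiableAt (by simp)).hasFDerivAt.pow 2
  have := congrArg (fun L : E3 →L[ℝ] ℝ => L e) (hs2.unique hsq)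
  simp at this
  rw [coe_radialProj hx, dot, inner_smul_left]
  have hx' : ‖x‖ ≠ 0 := norm_ne_zero_iff.2 hx
  simp
  field_simp
  linarith

theorem SphereC1.continuous_sphereGrad {f : S2 → ℝ} (hf : SphereC1 f) :
    Continuous (sphereGrad f) := by
  have h : ContinuousOn (fderiv ℝ (fun x : E3 => f (radialProj x))) {0}ᶜ :=
    ContDiffOn.continuousOn_fderiv_of_isOpen hf isOpen_compl_singleton le_rfl
  exact (InnerProductSpace.toDual ℝ E3).symm.continuous.comp
    (h.comp_continuous continuous_subtype_val coe_S2_ne_zero)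

theorem continuous_integrable {F : Type*} [NormedAddCommGroup F] {f : S2 → F}
    (hf : Continuous f) : Integrable f sphereMeasure := by
  have : IsFiniteMeasure sphereMeasure := inferInstanceAs (IsFiniteMeasure (volume : Measure E3).toSphere)
  exact hf.integrable_of_hasCompactSupport (HasCompactSupport.of_compactSpace f)

/-! ### Integration by parts on the sphere -/

/-- Polar coordinates: Lebesgue measure on `ℝ³` is the product of the surface measure and `r² dr`.
This is how integrals on the sphere are deduced from integrals on `ℝ³`. -/
theorem integral_radialProj_mul_norm (A : S2 → ℝ) (ρ : ℝ → ℝ) :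
    ∫ x : E3, A (radialProj x) * ρ ‖x‖ =
      (∫ η, A η ∂sphereMeasure) * ∫ r in Ioi (0 : ℝ), r ^ 2 * ρ r := by
  calc
    ∫ x : E3, A (radialProj x) * ρ ‖x‖
        = ∫ x : ({(0)}ᶜ : Set E3), A (radialProj x.1) * ρ ‖x.1‖
            ∂((volume : Measure E3).comap (↑)) := by
      rw [integral_subtype_comap (measurableSet_singleton _).compl
        fun x : E3 => A (radialProj x) * ρ ‖x‖, restrict_compl_singleton]
    _ = ∫ z : S2 × Ioi (0 : ℝ), A z.1 * ρ z.2
          ∂(volume : Measure E3).toSphere.prod (.volumeIoiPow (Module.finrank ℝ E3 - 1)) := by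
      rw [← (volume : Measure E3).measurePreserving_homeomorphUnitSphereProd.integral_comp
        (Homeomorph.measurableEmbedding _) (fun z : S2 × Ioi (0 : ℝ) => A z.1 * ρ z.2)]
      refine integral_congr_ae (Eventually.of_forall fun x => ?_)
      have : radialProj x.1 = (homeomorphUnitSphereProd E3 x).1 := by
        ext1
        rw [coe_radialProj x.2, homeomorphUnitSphereProd_apply_fst_coe]
      simp only [this, homeomorphUnitSphereProd_apply_snd_coe]
    _ = (∫ η, A η ∂sphereMeasure) *
          ∫ r : Ioi (0 : ℝ), ρ r ∂.volumeIoiPow (Module.finrank ℝ E3 - 1) :=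
      integral_prod_mul A fun r : Ioi (0 : ℝ) => ρ r
    _ = _ := by
      congr 1
      simp only [Measure.volumeIoiPow, ENNReal.ofReal, finrank_E3]
      rw [integral_withDensity_eq_integral_smul,
        integral_subtype_comap measurableSet_Ioi fun a ↦ Real.toNNReal (a ^ (3 - 1)) • ρ a,
        setIntegral_congr_fun measurableSet_Ioi fun x hx ↦ ?_]
      · rw [NNReal.smul_def, Real.coe_toNNReal _ (pow_nonneg hx.out.le _), smul_eq_mul]
      · exact (measurable_subtype_coe.pow_const _).real_toNNReal

theorem exists_radial_cutoff :
    ∃ χ : ℝ → ℝ, ContDiff ℝ ∞ χ ∧ (∀ r, r ∉ Icc 1 3 → χ r = 0) ∧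
      0 < ∫ r in Ioi (0 : ℝ), r * χ r := by
  -- The bump is centred at `2` with outer radius `1`: its support avoids `0`, where the radial
  -- extension is not smooth.
  let χ : ContDiffBump (2 : ℝ) := ⟨1 / 2, 1, by norm_num, by norm_num⟩
  have hsupp : ∀ r, r ∉ Icc (1 : ℝ) 3 → χ r = 0 := fun r hr => by
    refine χ.zero_of_le_dist ?_
    change 1 ≤ _
    rw [Real.dist_eq, le_abs]
    by_contra! h
    exact hr ⟨by linarith [h.2], by linarith [h.1]⟩
  have hzero : ∀ r ≤ 0, r * χ r = 0 := fun r hr => by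
    rw [hsupp r fun h => by linarith [h.1], mul_zero]
  refine ⟨χ, χ.contDiff, hsupp, ?_⟩
  rw [setIntegral_eq_integral_of_forall_compl_eq_zero fun r hr =>
    hzero r (not_lt.1 fun h => hr (mem_Ioi.2 h))]
  refine Continuous.integral_pos_of_hasCompactSupport_nonneg_nonzero (x := 2)
    (continuous_id.mul χ.continuous) χ.hasCompactSupport.mul_left ?_ ?_
  · intro r
    rcases le_total r 0 with h | h
    · simp [hzero r h]
    · exact mul_nonneg h χ.nonneg
  · have : χ 2 = 1 := χ.one_of_mem_closedBall (by simp [χ.rIn_pos.le])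
    simp [this]

theorem integral_fderiv_eq_zero_of_hasCompactSupport {G : E3 → ℝ} (hG : ContDiff ℝ 1 G)
    (hc : HasCompactSupport G) (e : E3) : ∫ x, fderiv ℝ G x e = 0 := by
  have h1 : Integrable fun x => fderiv ℝ G x e :=
    ((hG.continuous_fderiv (by simp)).clm_apply continuous_const).integrable_of_hasCompactSupport
      (hc.fderiv_apply ℝ e)
  have h2 : Integrable G := hG.continuous.integrable_of_hasCompactSupport hc
  -- Integration by parts against the constant function `1`.
  have := integral_mul_fderiv_eq_neg_fderiv_mul_of_integrable (μ := (volume : Measure E3))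
    (f := fun _ => (1 : ℝ)) (g := G) (v := e) (by simp) (by simpa using h1) (by simpa using h2)
    (fun x _ => differentiableAt_const _) (fun x _ => (hG.differentiable (by simp)) x)
  simpa using this

/-- Integration by parts on the sphere: the integral of the gradient of a `C¹` field `f` is the
integral of `2 f η`. -/
theorem integral_dot_sphereGrad {f : S2 → ℝ} (hf : SphereC1 f) (e : E3) :
    ∫ η, dot (sphereGrad f η) e ∂sphereMeasure =
      ∫ η : S2, 2 * (f η * dot η e) ∂sphereMeasure := by
  obtain ⟨χ, hχ, hχ0, hpos⟩ := exists_radial_cutoff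
  have hχd : ∀ r, HasDerivAt χ (deriv χ r) r := fun r =>
    (hχ.differentiable (by simp) r).hasDerivAt
  have hd0 : ∀ r, r ∉ Icc (1 : ℝ) 3 → deriv χ r = 0 := fun r hr => by
    have : χ =ᶠ[𝓝 r] fun _ => 0 := by
      filter_upwards [isClosed_Icc.isOpen_compl.mem_nhds hr] with s hs using hχ0 s hs
    rw [this.deriv_eq, deriv_const]
  have hdc : Continuous (deriv χ) := hχ.continuous_deriv (by simp)
  -- The derivative of the cut-off extension has integral zero on `ℝ³`. Polar coordinates split this
  -- integral into `∫ ∇f · e` times `∫ r χ` and `∫ f (η · e)` times `∫ r² χ'`.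
  let G : E3 → ℝ := fun x => f (radialProj x) * χ ‖x‖
  have hG0 : ∀ x : E3, ‖x‖ < 1 → G =ᶠ[𝓝 x] fun _ => 0 := fun x hx => by
    filter_upwards [(isOpen_lt continuous_norm continuous_const).mem_nhds hx] with z hz
    simp only [G]
    rw [hχ0 _ fun h => absurd h.1 (not_le.2 hz), mul_zero]
  have hGd : ContDiff ℝ 1 G := by
    rw [contDiff_iff_contDiffAt]
    intro x
    by_cases hx : x = 0
    · exact (contDiffAt_const (c := (0 : ℝ))).congr_of_eventuallyEq (hG0 x (by simp [hx]))
    · exact (hf.contDiffAt hx).mul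
        (((hχ.of_le (by simp)).contDiffAt).comp x (contDiffAt_norm ℝ hx))
  have hGc : HasCompactSupport G := by
    refine HasCompactSupport.of_support_subset_isCompact (isCompact_closedBall (0 : E3) 3) ?_
    intro x hx
    by_contra h
    refine hx ?_
    simp only [G]
    rw [hχ0 _ fun h' => h (by simpa using h'.2), mul_zero]
  have hint := integral_fderiv_eq_zero_of_hasCompactSupport hGd hGc e
  have hformula : ∀ x : E3, x ≠ 0 → fderiv ℝ G x e =
      (dot (sphereGrad f (radialProj x)) e) * (‖x‖⁻¹ * χ ‖x‖) +
        (f (radialProj x) * dot (radialProj x) e) * deriv χ ‖x‖ := by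
    intro x hx
    have h1 := ((hf.contDiffAt hx).differentiableAt (by simp)).hasFDerivAt
    have h2 := (hχd ‖x‖).comp_hasFDerivAt x
      ((contDiffAt_norm ℝ hx (n := 1)).differentiableAt (by simp)).hasFDerivAt
    have h3 : HasFDerivAt G _ x := h1.mul h2
    rw [h3.fderiv]
    simp only [add_apply, smul_apply, smul_eq_mul]
    rw [fderiv_norm_apply hx, fderiv_comp_radialProj f hx]
    ring
  have hae : ∀ᵐ x : E3, x ≠ 0 := by
    simp [ae_iff]
  rw [integral_congr_ae (hae.mono hformula)] at hint
  have hg1 : Integrable fun x : E3 => fderiv ℝ G x e :=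
    ((hGd.continuous_fderiv (by simp)).clm_apply continuous_const).integrable_of_hasCompactSupport
      (hGc.fderiv_apply ℝ e)
  have hg2 : Integrable fun x : E3 =>
      (f (radialProj x) * dot (radialProj x) e) * deriv χ ‖x‖ := by
    refine Continuous.integrable_of_hasCompactSupport (continuous_iff_continuousAt.2 fun x => ?_) ?_
    · by_cases hx : x = 0
      · have : (fun x : E3 => (f (radialProj x) * dot (radialProj x) e) * deriv χ ‖x‖)
            =ᶠ[𝓝 x] fun _ => 0 := by
          filter_upwards [(isOpen_lt continuous_norm continuous_const).mem_nhds
            (show ‖x‖ < 1 by simp [hx])] with z hz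
          rw [hd0 _ fun h => absurd h.1 (not_le.2 hz), mul_zero]
        exact continuousAt_const.congr this.symm
      · have hr : ContinuousAt radialProj x := (contMDiffAt_radialProj hx).continuousAt
        refine ((hf.continuous.continuousAt.comp hr).mul ?_).mul
          (hdc.comp continuous_norm).continuousAt
        exact ((continuous_subtype_val.continuousAt.comp hr).inner continuousAt_const)
    · refine HasCompactSupport.of_support_subset_isCompact (isCompact_closedBall (0 : E3) 3) ?_
      intro x hx
      by_contra h
      refine hx ?_
      simp only
      rw [hd0 _ fun h' => h (by simpa using h'.2), mul_zero]
  have hg3 : Integrable fun x : E3 =>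
      (dot (sphereGrad f (radialProj x)) e) * (‖x‖⁻¹ * χ ‖x‖) := by
    refine (hg1.sub hg2).congr (hae.mono fun x hx => ?_)
    simp only [Pi.sub_apply]
    rw [hformula x hx]
    ring
  rw [integral_add hg3 hg2,
    integral_radialProj_mul_norm (fun η => dot (sphereGrad f η) e) fun r => r⁻¹ * χ r,
    integral_radialProj_mul_norm (fun η : S2 => f η * dot η e) (deriv χ)] at hint
  have hr1 : ∫ r in Ioi (0 : ℝ), r ^ 2 * (r⁻¹ * χ r) = ∫ r in Ioi (0 : ℝ), r * χ r := by
    refine setIntegral_congr_fun measurableSet_Ioi fun r hr => ?_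
    have : r ≠ 0 := (mem_Ioi.1 hr).ne'
    field_simp
  have hsup : ∀ u : ℝ → ℝ, Continuous u → (∀ r, r ∉ Icc (1 : ℝ) 3 → u r = 0) → Integrable u :=
    fun u hu h0 => hu.integrable_of_hasCompactSupport
      (HasCompactSupport.intro isCompact_Icc h0)
  have hi1 : Integrable fun r => r ^ 2 * deriv χ r :=
    hsup _ ((continuous_pow 2).mul hdc) fun r hr => by simp [hd0 r hr]
  have hi2 : Integrable fun r => 2 * (r * χ r) :=
    hsup _ (continuous_const.mul (continuous_id.mul hχ.continuous)) fun r hr => by simp [hχ0 r hr]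
  have hi3 : Integrable fun r => r ^ 2 * χ r :=
    hsup _ ((continuous_pow 2).mul hχ.continuous) fun r hr => by simp [hχ0 r hr]
  -- The factor `2` of the formula comes from here, by integrating `(r² χ)'`.
  have hr2 : ∫ r in Ioi (0 : ℝ), r ^ 2 * deriv χ r = -(2 * ∫ r in Ioi (0 : ℝ), r * χ r) := by
    rw [setIntegral_eq_integral_of_forall_compl_eq_zero fun r hr => by
        rw [hd0 r fun h => hr (mem_Ioi.2 (by linarith [h.1])), mul_zero],
      setIntegral_eq_integral_of_forall_compl_eq_zero fun r hr => by
        rw [hχ0 r fun h => hr (mem_Ioi.2 (by linarith [h.1])), mul_zero]]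
    have := integral_eq_zero_of_hasDerivAt_of_integrable
      (f := fun r : ℝ => r ^ 2 * χ r) (f' := fun r => 2 * (r * χ r) + r ^ 2 * deriv χ r)
      (fun r => by
        convert! (hasDerivAt_pow 2 r).mul (hχd r) using 1
        push_cast
        ring) (hi2.add hi1) hi3
    rw [integral_add hi2 hi1, integral_const_mul] at this
    linarith
  rw [hr1, hr2] at hint
  rw [integral_const_mul]
  have : (∫ r in Ioi (0 : ℝ), r * χ r) * ((∫ η, dot (sphereGrad f η) e ∂sphereMeasure) -
      2 * ∫ η : S2, f η * dot η e ∂sphereMeasure) = 0 := by linarith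
  rcases mul_eq_zero.1 this with h | h
  · exact absurd h hpos.ne'
  · linarith

/-! ### The wedge product -/

theorem cross_sub_left (a b c : E3) : cross (a - b) c = cross a c - cross b c := by
  simp [cross]

theorem cross_sub_right (a b c : E3) : cross a (b - c) = cross a b - cross a c := by
  simp [cross]

theorem cross_smul_left (r : ℝ) (a b : E3) : cross (r • a) b = r • cross a b := by
  simp [cross]

theorem norm_cross_le (a b : E3) : ‖cross a b‖ ≤ ‖a‖ * ‖b‖ := by
  refine abs_le_of_sq_le_sq' ?_ (by positivity) |>.2
  rw [mul_pow, EuclideanSpace.norm_sq_eq, EuclideanSpace.norm_sq_eq, EuclideanSpace.norm_sq_eq]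
  simp only [Fin.sum_univ_three, Real.norm_eq_abs, sq_abs, cross, cross_apply]
  simp
  -- Lagrange's identity: the defect `‖a‖²‖b‖² - ‖a × b‖²` is the square of the scalar product.
  nlinarith [sq_nonneg (a 0 * b 0 + a 1 * b 1 + a 2 * b 2)]

theorem continuous_cross : Continuous fun p : E3 × E3 => cross p.1 p.2 := by
  refine (PiLp.continuous_toLp 2 _).comp (continuous_pi fun i => ?_)
  fin_cases i <;> simp [cross_apply] <;> fun_prop

/-- The double wedge product is `(η · g)η - ‖η‖² g`. For tangent vectors it is only a sign, which
turns the integrand of the linear bias equation into a weighted gradient. -/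
theorem cross_cross_of_dot_eq_zero (η : S2) {g : E3} (h : dot g η = 0) :
    cross η (cross η g) = -g := by
  have h1 : (η : E3) 0 ^ 2 + (η : E3) 1 ^ 2 + (η : E3) 2 ^ 2 = 1 := by
    have := EuclideanSpace.norm_sq_eq (η : E3)
    rw [norm_coe_S2] at this
    simpa [Fin.sum_univ_three] using this.symm
  have h2 : (η : E3) 0 * g 0 + (η : E3) 1 * g 1 + (η : E3) 2 * g 2 = 0 := by
    simpa [dot, PiLp.inner_apply, Fin.sum_univ_three] using h
  ext i
  fin_cases i
  · simp [cross, cross_apply]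
    linear_combination (η : E3) 0 * h2 - g 0 * h1
  · simp [cross, cross_apply]
    linear_combination (η : E3) 1 * h2 - g 1 * h1
  · simp [cross, cross_apply]
    linear_combination (η : E3) 2 * h2 - g 2 * h1

/-- The splitting is asymmetric on purpose: the difference of the inverse depths multiplies `v'`
alone. When `v'` is the corrected velocity of the limit observer, no a priori bound on the other one
is needed. -/
theorem norm_flowField_sub_le (w v w' v' : E3) (d d' : ℝ) (η : S2) :
    ‖flowField w v d η - flowField w' v' d' η‖ ≤
      ‖w - w'‖ + |1 / d| * ‖v - v'‖ + |1 / d - 1 / d'| * ‖v'‖ := by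
  have h : flowField w v d η - flowField w' v' d' η =
      cross η ((w - w') + ((1 / d) • cross η (v - v') + (1 / d - 1 / d') • cross η v')) := by
    rw [flowField, flowField, ← cross_sub_right, cross_sub_right (η : E3) v v']
    refine congrArg _ ?_
    module
  have hη : ∀ u : E3, ‖cross η u‖ ≤ ‖u‖ := fun u => by
    simpa [norm_coe_S2] using norm_cross_le (η : E3) u
  rw [h]
  refine (hη _).trans ((norm_add_le _ _).trans ?_)
  rw [add_assoc]
  gcongr
  refine (norm_add_le _ _).trans ?_
  rw [norm_smul, norm_smul, Real.norm_eq_abs, Real.norm_eq_abs]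
  gcongr <;> exact hη _

/-! ### Vector forms of the integration by parts -/

/-- The gradient of a linear form on the sphere is the tangential part of its vector:
differentiating `‖x‖⁻¹` removes the radial part. -/
theorem hasSphereGrad_inner (a : E3) (η : S2) :
    HasSphereGrad (fun ξ : S2 => inner ℝ a (ξ : E3)) (a - dot a η • (η : E3)) η := by
  have h0 := coe_S2_ne_zero η
  have hn : HasFDerivAt (fun x : E3 => ‖x‖) _ (η : E3) :=
    ((contDiffAt_norm ℝ h0 (n := 1)).differentiableAt (by simp)).hasFDerivAt
  have hi := (hasDerivAt_inv (norm_ne_zero_iff.2 h0)).comp_hasFDerivAt (η : E3) hn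
  have hm := hi.mul (innerSL ℝ a).hasFDerivAt
  have hG : HasFDerivAt (fun x : E3 => inner ℝ a (radialProj x : E3))
      (fderiv ℝ (fun x : E3 => inner ℝ a (radialProj x : E3)) η) η :=
    ((sphereC1_inner a).differentiableAt η).hasFDerivAt
  have he : (fun x : E3 => inner ℝ a (radialProj x : E3)) =ᶠ[𝓝 (η : E3)]
      (Inv.inv ∘ fun x : E3 => ‖x‖) * fun x => innerSL ℝ a x := by
    filter_upwards [isOpen_compl_singleton.mem_nhds h0] with x hx
    rw [coe_radialProj hx, inner_smul_right]
    simp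
  have hm' := hm.congr_of_eventuallyEq he
  unfold HasSphereGrad
  rw [hasGradientAt_iff_hasFDerivAt]
  refine hm'.congr_fderiv (ContinuousLinearMap.ext fun e => ?_)
  simp only [add_apply, smul_apply, smul_eq_mul, fderiv_norm_apply h0, radialProj_coe,
    InnerProductSpace.toDual_apply_apply, inner_sub_left, inner_smul_left, dot]
  simp
  ring

theorem integral_sphereGrad {f : S2 → ℝ} (hf : SphereC1 f) :
    ∫ η, sphereGrad f η ∂sphereMeasure = ∫ η : S2, (2 * f η) • (η : E3) ∂sphereMeasure := by
  have hi : Integrable (fun η : S2 => (2 * f η) • (η : E3)) sphereMeasure :=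
    continuous_integrable ((continuous_const.mul hf.continuous).smul continuous_subtype_val)
  refine ext_inner_left ℝ fun e => ?_
  rw [← integral_inner (continuous_integrable hf.continuous_sphereGrad), ← integral_inner hi]
  have := integral_dot_sphereGrad hf e
  simp only [dot] at this
  simp only [fun u : E3 => real_inner_comm u e, this, inner_smul_left, RCLike.conj_to_real,
    mul_assoc]

theorem continuous_cross_sphereGrad {f : S2 → ℝ} (hf : SphereC1 f) :
    Continuous fun η : S2 => cross (sphereGrad f η) η :=
  continuous_cross.comp (hf.continuous_sphereGrad.prodMk continuous_subtype_val)

/-- The field `∇f · b (a · η) - ∇f · a (b · η)` has mean zero. -/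
theorem integral_antisymm_sphereGrad {f : S2 → ℝ} (hf : SphereC1 f) (a b : E3) :
    ∫ η : S2, (inner ℝ a (η : E3) * dot (sphereGrad f η) b
      - inner ℝ b (η : E3) * dot (sphereGrad f η) a) ∂sphereMeasure = 0 := by
  -- Integration by parts is applied to `f (a · η)` along `b` and to `f (b · η)` along `a`. The
  -- terms without `∇f` and the right-hand sides are symmetric in `a`, `b`, so they cancel in the
  -- difference.
  have key : ∀ a b : E3, ∀ η : S2,
      dot (sphereGrad (fun ξ => f ξ * inner ℝ a (ξ : E3)) η) b =
        f η * (dot a b - dot a η * dot η b) + inner ℝ a (η : E3) * dot (sphereGrad f η) b := by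
    intro a b η
    rw [((hf.hasSphereGrad η).mul (hasSphereGrad_inner a η)).sphereGrad_eq]
    simp only [dot, inner_add_left, inner_smul_left, inner_sub_left]
    simp
  have hint : ∀ a b : E3, Integrable (fun η : S2 =>
      dot (sphereGrad (fun ξ => f ξ * inner ℝ a (ξ : E3)) η) b) sphereMeasure := fun a b =>
    continuous_integrable
      ((hf.mul (sphereC1_inner a)).continuous_sphereGrad.inner continuous_const)
  have h1 := integral_dot_sphereGrad (hf.mul (sphereC1_inner a)) b
  have h2 := integral_dot_sphereGrad (hf.mul (sphereC1_inner b)) a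
  have h3 : ∫ η : S2, 2 * (f η * inner ℝ a (η : E3) * dot η b) ∂sphereMeasure =
      ∫ η : S2, 2 * (f η * inner ℝ b (η : E3) * dot η a) ∂sphereMeasure := by
    refine integral_congr_ae (Eventually.of_forall fun η => ?_)
    simp only [dot]
    rw [real_inner_comm a (η : E3), real_inner_comm b (η : E3)]
    ring
  rw [h3, ← h2, ← sub_eq_zero, ← integral_sub (hint a b) (hint b a)] at h1
  rw [← h1]
  refine integral_congr_ae (Eventually.of_forall fun η => ?_)
  simp only [key]
  simp only [dot]
  rw [real_inner_comm a (η : E3), real_inner_comm b (η : E3), real_inner_comm a b]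
  ring

/-- Each coordinate of `∇f × η` is an antisymmetric expression in two basis vectors, of mean zero by
the previous lemma. -/
theorem integral_cross_sphereGrad {f : S2 → ℝ} (hf : SphereC1 f) :
    ∫ η : S2, cross (sphereGrad f η) η ∂sphereMeasure = 0 := by
  have hc : ∀ i j k : Fin 3,
      (∀ η : S2, cross (sphereGrad f η) η i =
        inner ℝ (EuclideanSpace.single k (1 : ℝ)) (η : E3) *
          dot (sphereGrad f η) (EuclideanSpace.single j 1)
        - inner ℝ (EuclideanSpace.single j (1 : ℝ)) (η : E3) *
          dot (sphereGrad f η) (EuclideanSpace.single k 1)) →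
      (∫ η : S2, cross (sphereGrad f η) η ∂sphereMeasure) i = 0 := by
    intro i j k h
    have h1 : ∫ η : S2, cross (sphereGrad f η) η i ∂sphereMeasure =
        (∫ η : S2, cross (sphereGrad f η) η ∂sphereMeasure) i :=
      ContinuousLinearMap.integral_comp_comm (EuclideanSpace.proj (𝕜 := ℝ) i)
        (continuous_integrable (continuous_cross_sphereGrad hf))
    rw [← h1, ← integral_antisymm_sphereGrad hf (EuclideanSpace.single k 1)
      (EuclideanSpace.single j 1)]
    exact integral_congr_ae (Eventually.of_forall h)
  ext i
  fin_cases i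
  · exact hc 0 1 2 fun η => by simp [cross, cross_apply, dot, EuclideanSpace.inner_single_left,
      EuclideanSpace.inner_single_right]; ring
  · exact hc 1 2 0 fun η => by simp [cross, cross_apply, dot, EuclideanSpace.inner_single_left,
      EuclideanSpace.inner_single_right]; ring
  · exact hc 2 0 1 fun η => by simp [cross, cross_apply, dot, EuclideanSpace.inner_single_left,
      EuclideanSpace.inner_single_right]; ring

/-! ### Time-dependent fields of class `C¹` -/

/-- The radial projection is `C¹` off the origin, so regularity on the manifold transfers to a
vector space, where gradients are ordinary partial derivatives. -/
theorem FieldC1.contDiffOn {f : ℝ → S2 → ℝ} (hf : FieldC1 f) :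
    ContDiffOn ℝ 1 (fun p : ℝ × E3 => f p.1 (radialProj p.2)) (Ici (0 : ℝ) ×ˢ {0}ᶜ) := by
  rw [← contMDiffOn_iff_contDiffOn]
  intro p hp
  have h1 : ContMDiffWithinAt 𝓘(ℝ, ℝ × E3) 𝓘(ℝ, ℝ) 1 (Prod.fst : ℝ × E3 → ℝ)
      (Ici (0 : ℝ) ×ˢ {0}ᶜ) p := contDiffWithinAt_fst.contMDiffWithinAt
  have h2 : ContMDiffWithinAt 𝓘(ℝ, ℝ × E3) 𝓘(ℝ, E3) 1 (Prod.snd : ℝ × E3 → E3)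
      (Ici (0 : ℝ) ×ˢ {0}ᶜ) p := contDiffWithinAt_snd.contMDiffWithinAt
  have h3 : ContMDiffWithinAt 𝓘(ℝ, ℝ × E3) (𝓡 2) 1 (fun p : ℝ × E3 => radialProj p.2)
      (Ici (0 : ℝ) ×ˢ {0}ᶜ) p :=
    (contMDiffAt_radialProj (x := p.2) hp.2).comp_contMDiffWithinAt p h2
  exact ContMDiffWithinAt.comp p (hf (p.1, radialProj p.2) ⟨hp.1, mem_univ _⟩)
    (h1.prodMk h3) fun q hq => mem_prod.2 ⟨(mem_prod.1 hq).1, mem_univ _⟩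

theorem FieldC1.sphereC1 {f : ℝ → S2 → ℝ} (hf : FieldC1 f) {t : ℝ} (ht : 0 ≤ t) :
    SphereC1 (f t) :=
  hf.contDiffOn.comp (s := {0}ᶜ) (f := fun x : E3 => (t, x)) (contDiffOn_const.prodMk contDiffOn_id)
    (t := Ici (0 : ℝ) ×ˢ {0}ᶜ) fun _ hx => mem_prod.2 ⟨ht, hx⟩

theorem FieldC1.continuousOn {f : ℝ → S2 → ℝ} (hf : FieldC1 f) :
    ContinuousOn (fun p : ℝ × S2 => f p.1 p.2) (Ici (0 : ℝ) ×ˢ univ) :=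
  ContMDiffOn.continuousOn hf

theorem FieldC1.continuousOn_sphereGrad {f : ℝ → S2 → ℝ} (hf : FieldC1 f) :
    ContinuousOn (fun p : ℝ × S2 => sphereGrad (f p.1) p.2) (Ici (0 : ℝ) ×ˢ univ) := by
  set s : Set (ℝ × E3) := Ici (0 : ℝ) ×ˢ {0}ᶜ with hs
  have hu : UniqueDiffOn ℝ s := (uniqueDiffOn_Ici 0).prod isOpen_compl_singleton.uniqueDiffOn
  have hc := hf.contDiffOn.continuousOn_fderivWithin hu le_rfl
  -- The gradient is the joint derivative restricted to spatial directions, which gives its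
  -- continuity jointly in time and space.
  have hslice : ∀ p ∈ Ici (0 : ℝ) ×ˢ (univ : Set S2), sphereGrad (f p.1) p.2 =
      (InnerProductSpace.toDual ℝ E3).symm
        ((fderivWithin ℝ (fun p : ℝ × E3 => f p.1 (radialProj p.2)) s (p.1, (p.2 : E3))).comp
          (ContinuousLinearMap.inr ℝ ℝ E3)) := by
    intro p hp
    have hmem : (p.1, (p.2 : E3)) ∈ s := ⟨hp.1, coe_S2_ne_zero p.2⟩
    have h1 := (hf.contDiffOn.differentiableOn (by simp) _ hmem).hasFDerivWithinAt
    have h2 : HasFDerivWithinAt (fun x : E3 => (p.1, x)) (ContinuousLinearMap.inr ℝ ℝ E3)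
        {0}ᶜ (p.2 : E3) := (hasFDerivAt_prodMk_right p.1 (p.2 : E3)).hasFDerivWithinAt
    have h3 := (h1.comp (p.2 : E3) h2 fun x hx => ⟨hp.1, hx⟩).hasFDerivAt
      (isOpen_compl_singleton.mem_nhds (coe_S2_ne_zero p.2))
    rw [sphereGrad, gradient]
    exact congrArg _ h3.fderiv
  refine ContinuousOn.congr ?_ hslice
  refine (InnerProductSpace.toDual ℝ E3).symm.continuous.comp_continuousOn ?_
  refine ContinuousOn.clm_comp (hc.comp ?_ fun p hp => ⟨hp.1, coe_S2_ne_zero p.2⟩)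
    continuousOn_const
  exact (continuous_fst.prodMk (continuous_subtype_val.comp continuous_snd)).continuousOn

theorem exists_bound_field {F : Type*} [NormedAddCommGroup F] {f : ℝ × S2 → F}
    (hf : ContinuousOn f (Ici (0 : ℝ) ×ˢ univ)) (T : ℝ) :
    ∃ C, ∀ t ∈ Icc 0 T, ∀ η, ‖f (t, η)‖ ≤ C := by
  obtain ⟨C, hC⟩ := (isCompact_Icc.prod isCompact_univ).exists_bound_of_continuousOn
    (hf.mono (prod_mono (fun t ht => ht.1) (subset_univ univ)) :
      ContinuousOn f (Icc 0 T ×ˢ univ))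
  exact ⟨C, fun t ht η => hC (t, η) ⟨ht, mem_univ _⟩⟩

/-- The radial extension takes only values of `f`, so a maximum of `f` on the sphere is a maximum of
the extension. -/
theorem sphereGrad_eq_zero_of_forall_le {f : S2 → ℝ} {η : S2} (h : ∀ ξ, f ξ ≤ f η) :
    sphereGrad f η = 0 := by
  have hm : IsLocalMax (fun x : E3 => f (radialProj x)) (η : E3) :=
    Eventually.of_forall fun x => by
      simp only [radialProj_coe]
      exact h _
  rw [sphereGrad, gradient, hm.fderiv_eq_zero, map_zero]

section

/-! ### Stability of the right-hand sides of the bias equations -/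

/-- Bounds on two pairs of fields that are `B`-close in the sup norm, in which the gradients
of `f` and `g'` are controlled, but not that of `f'`. -/
structure CloseFields (M B : ℝ) (f' g' f g : S2 → ℝ) : Prop where
  f'_C1 : SphereC1 f'
  g'_C1 : SphereC1 g'
  f_C1 : SphereC1 f
  g_C1 : SphereC1 g
  f_le : ∀ η, |f η| ≤ M
  g_le : ∀ η, |g η| ≤ M
  grad_f_le : ∀ η, ‖sphereGrad f η‖ ≤ M
  grad_g'_le : ∀ η, ‖sphereGrad g' η‖ ≤ M
  f_close : ∀ η, |f' η - f η| ≤ B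
  g_close : ∀ η, |g' η - g η| ≤ B

/-- Bounds on two weights that are close in the sup norm. -/
structure CloseWeights (M B : ℝ) (a' a : S2 → ℝ) : Prop where
  a'_C1 : SphereC1 a'
  a_C1 : SphereC1 a
  a'_le : ∀ η, |a' η| ≤ M
  grad_a'_le : ∀ η, ‖sphereGrad a' η‖ ≤ M
  a_close : ∀ η, |a' η - a η| ≤ M * B

variable {M B : ℝ} {f' g' f g a' a : S2 → ℝ}

theorem sphereGrad_const (c : ℝ) (η : S2) : sphereGrad (fun _ => c) η = 0 :=
  sphereGrad_eq_zero_of_forall_le fun _ => le_rfl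

theorem closeWeights_one (hM : 1 ≤ M) (hB : 0 ≤ B) :
    CloseWeights M B (fun _ => 1) fun _ => 1 where
  a'_C1 := sphereC1_const 1
  a_C1 := sphereC1_const 1
  a'_le _ := by simpa using hM
  grad_a'_le η := by
    rw [sphereGrad_const, norm_zero]
    linarith
  a_close _ := by
    simp only [sub_self, abs_zero]
    positivity

/-- The difference of two weighted products `a (f - g) ∇f` is a small gradient up to a small
remainder. -/
theorem CloseFields.exists_sphereGrad_approx (h : CloseFields M B f' g' f g)
    (hw : CloseWeights M B a' a) (hM : 1 ≤ M) (hB : 0 ≤ B) (hB1 : B ≤ 1) :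
    ∃ q : S2 → ℝ, SphereC1 q ∧ (∀ η, |q η| ≤ 7 * M ^ 3 * B) ∧
      ∀ η, ‖(a' η * (f' η - g' η)) • sphereGrad f' η - (a η * (f η - g η)) • sphereGrad f η
        - (1 / 2 : ℝ) • sphereGrad q η‖ ≤ 8 * M ^ 3 * B := by
  have hP := h.f'_C1.sub h.g'_C1
  have hQ := h.f_C1.sub h.g'_C1
  have hM2 : M ^ 2 * B ≤ M ^ 3 * B :=
    mul_le_mul_of_nonneg_right (pow_le_pow_right₀ hM (by norm_num)) hB
  have hM0 : 0 ≤ M := by linarith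
  -- Each difference is at most `2M` up to multiples of `B`, and `B ≤ 1 ≤ M`: the sum is at most `4M
  -- + 3B ≤ 7M`.
  have hs : ∀ η, |(f' η - g' η) + (f η - g' η)| ≤ 7 * M := fun η => by
    have h1 := abs_le.1 (h.f_close η)
    have h2 := abs_le.1 (h.g_close η)
    have h3 := abs_le.1 (h.f_le η)
    have h4 := abs_le.1 (h.g_le η)
    rw [abs_le]
    constructor <;> linarith
  -- The witness is `a'((f' - g')² - (f - g')²)`. Having `g'` in both squares makes their difference
  -- a multiple of `f' - f`, and keeps `∇g` out of the remainder.
  refine ⟨_, hw.a'_C1.mul ((hP.mul hP).sub (hQ.mul hQ)), fun η => ?_, fun η => ?_⟩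
  · have : a' η * ((f' η - g' η) * (f' η - g' η) - (f η - g' η) * (f η - g' η)) =
        a' η * (f' η - f η) * ((f' η - g' η) + (f η - g' η)) := by ring
    rw [this, abs_mul, abs_mul]
    calc |a' η| * |f' η - f η| * |(f' η - g' η) + (f η - g' η)|
        ≤ M * B * (7 * M) := by
          gcongr
          · exact hw.a'_le η
          · exact h.f_close η
          · exact hs η
      _ ≤ 7 * M ^ 3 * B := by nlinarith
  · have hgP := (h.f'_C1.hasSphereGrad η).sub (h.g'_C1.hasSphereGrad η)
    have hgQ := (h.f_C1.hasSphereGrad η).sub (h.g'_C1.hasSphereGrad η)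
    rw [((hw.a'_C1.hasSphereGrad η).mul ((hgP.mul hgP).sub (hgQ.mul hgQ))).sphereGrad_eq]
    -- In the remainder all terms in `∇f'` have cancelled.
    have hR : (a' η * (f' η - g' η)) • sphereGrad f' η - (a η * (f η - g η)) • sphereGrad f η
        - (1 / 2 : ℝ) • (a' η • ((f' η - g' η) • (sphereGrad f' η - sphereGrad g' η)
            + (f' η - g' η) • (sphereGrad f' η - sphereGrad g' η)
            - ((f η - g' η) • (sphereGrad f η - sphereGrad g' η)
              + (f η - g' η) • (sphereGrad f η - sphereGrad g' η)))
          + ((f' η - g' η) * (f' η - g' η) - (f η - g' η) * (f η - g' η)) • sphereGrad a' η) =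
        (a' η * (f' η - f η)) • sphereGrad g' η + (-(a' η * (g' η - g η))) • sphereGrad f η
          + ((a' η - a η) * (f η - g η)) • sphereGrad f η
          + (-(1 / 2) * (f' η - f η) * ((f' η - g' η) + (f η - g' η))) • sphereGrad a' η := by
      module
    rw [hR]
    have hfg : |f η - g η| ≤ 2 * M := (abs_sub _ _).trans (by linarith [h.f_le η, h.g_le η])
    refine (norm_add_le _ _).trans ?_
    refine (add_le_add (norm_add_le _ _) le_rfl).trans ?_
    refine (add_le_add (add_le_add (norm_add_le _ _) le_rfl) le_rfl).trans ?_
    simp only [norm_smul, Real.norm_eq_abs, abs_neg, abs_mul]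
    have e1 : |a' η| * |f' η - f η| * ‖sphereGrad g' η‖ ≤ M * B * M := by
      gcongr
      exacts [hw.a'_le η, h.f_close η, h.grad_g'_le η]
    have e2 : |a' η| * |g' η - g η| * ‖sphereGrad f η‖ ≤ M * B * M := by
      gcongr
      exacts [hw.a'_le η, h.g_close η, h.grad_f_le η]
    have e3 : |a' η - a η| * |f η - g η| * ‖sphereGrad f η‖ ≤ (M * B) * (2 * M) * M := by
      gcongr
      exacts [hw.a_close η, h.grad_f_le η]
    have e4 : |(1 / 2 : ℝ)| * |f' η - f η| * |(f' η - g' η) + (f η - g' η)| * ‖sphereGrad a' η‖ ≤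
        1 / 2 * B * (7 * M) * M := by
      rw [abs_of_pos (by norm_num : (0 : ℝ) < 1 / 2)]
      gcongr
      exacts [h.f_close η, hs η, hw.grad_a'_le η]
    nlinarith

theorem norm_integral_sphere_le {F : S2 → E3} {C : ℝ} (h : ∀ η, ‖F η‖ ≤ C) :
    ‖∫ η, F η ∂sphereMeasure‖ ≤ C * sphereMeasure.real univ := by
  have : IsFiniteMeasure sphereMeasure :=
    inferInstanceAs (IsFiniteMeasure (volume : Measure E3).toSphere)
  exact norm_integral_le_of_norm_le_const (Eventually.of_forall h)

theorem SphereC1.continuous_weighted_grad (ha : SphereC1 a) (hf : SphereC1 f) (hg : SphereC1 g) :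
    Continuous fun η => (a η * (f η - g η)) • sphereGrad f η :=
  (ha.mul (hf.sub hg)).continuous.smul hf.continuous_sphereGrad

/-- The remainder contributes `8`, and `½∫∇q = ½∫2qη` contributes `7`. -/
theorem CloseFields.norm_integral_weighted_grad_sub_le (h : CloseFields M B f' g' f g)
    (hw : CloseWeights M B a' a) (hM : 1 ≤ M) (hB : 0 ≤ B) (hB1 : B ≤ 1) :
    ‖(∫ η, (a' η * (f' η - g' η)) • sphereGrad f' η ∂sphereMeasure)
      - ∫ η, (a η * (f η - g η)) • sphereGrad f η ∂sphereMeasure‖ ≤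
      15 * M ^ 3 * B * sphereMeasure.real univ := by
  obtain ⟨q, hq, hq1, hq2⟩ := h.exists_sphereGrad_approx hw hM hB hB1
  have i1 := continuous_integrable (hw.a'_C1.continuous_weighted_grad h.f'_C1 h.g'_C1)
  have i2 := continuous_integrable (hw.a_C1.continuous_weighted_grad h.f_C1 h.g_C1)
  have i3 : Integrable (fun η => (1 / 2 : ℝ) • sphereGrad q η) sphereMeasure :=
    continuous_integrable (hq.continuous_sphereGrad.const_smul (1 / 2 : ℝ))
  have e : (∫ η, (a' η * (f' η - g' η)) • sphereGrad f' η ∂sphereMeasure)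
      - ∫ η, (a η * (f η - g η)) • sphereGrad f η ∂sphereMeasure =
      (∫ η, ((a' η * (f' η - g' η)) • sphereGrad f' η - (a η * (f η - g η)) • sphereGrad f η
        - (1 / 2 : ℝ) • sphereGrad q η) ∂sphereMeasure)
      + (1 / 2 : ℝ) • ∫ η : S2, (2 * q η) • (η : E3) ∂sphereMeasure := by
    have e' := integral_sub (i1.sub i2) i3
    simp only [Pi.sub_apply] at e'
    rw [e', integral_sub i1 i2, integral_smul, integral_sphereGrad hq]
    abel
  rw [e]
  refine (norm_add_le _ _).trans ((add_le_add (norm_integral_sphere_le hq2)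
    (norm_smul_le _ _)).trans ?_)
  have h2 : ‖∫ η : S2, (2 * q η) • (η : E3) ∂sphereMeasure‖ ≤
      14 * M ^ 3 * B * sphereMeasure.real univ := by
    refine norm_integral_sphere_le fun η => ?_
    rw [norm_smul, norm_coe_S2, mul_one, Real.norm_eq_abs, abs_mul, abs_two]
    linarith [hq1 η]
  rw [Real.norm_eq_abs, abs_of_pos (by norm_num : (0 : ℝ) < 1 / 2)]
  linarith

theorem SphereC1.continuous_cross_grad (hf : SphereC1 f) (hg : SphereC1 g) :
    Continuous fun η : S2 => (f η - g η) • cross (sphereGrad f η) η :=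
  (hf.sub hg).continuous.smul (continuous_cross_sphereGrad hf)

/-- Here `½∇q × η` integrates to zero, so the remainder alone counts. -/
theorem CloseFields.norm_integral_cross_grad_sub_le (h : CloseFields M B f' g' f g)
    (hM : 1 ≤ M) (hB : 0 ≤ B) (hB1 : B ≤ 1) :
    ‖(∫ η : S2, (f' η - g' η) • cross (sphereGrad f' η) η ∂sphereMeasure)
      - ∫ η : S2, (f η - g η) • cross (sphereGrad f η) η ∂sphereMeasure‖ ≤
      8 * M ^ 3 * B * sphereMeasure.real univ := by
  obtain ⟨q, hq, -, hq2⟩ := h.exists_sphereGrad_approx (closeWeights_one hM hB) hM hB hB1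
  have i1 := continuous_integrable (h.f'_C1.continuous_cross_grad h.g'_C1)
  have i2 := continuous_integrable (h.f_C1.continuous_cross_grad h.g_C1)
  have i3 : Integrable (fun η : S2 => (1 / 2 : ℝ) • cross (sphereGrad q η) η) sphereMeasure :=
    continuous_integrable ((continuous_cross_sphereGrad hq).const_smul (1 / 2 : ℝ))
  have e : (∫ η : S2, (f' η - g' η) • cross (sphereGrad f' η) η ∂sphereMeasure)
      - ∫ η : S2, (f η - g η) • cross (sphereGrad f η) η ∂sphereMeasure =
      ∫ η : S2, cross ((1 * (f' η - g' η)) • sphereGrad f' η - (1 * (f η - g η)) • sphereGrad f η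
        - (1 / 2 : ℝ) • sphereGrad q η) η ∂sphereMeasure := by
    simp only [one_mul, cross_sub_left, cross_smul_left]
    have e' := integral_sub (i1.sub i2) i3
    simp only [Pi.sub_apply] at e'
    rw [e', integral_sub i1 i2, integral_smul,
      integral_cross_sphereGrad hq, smul_zero, sub_zero]
  rw [e]
  refine norm_integral_sphere_le fun η => ?_
  refine (norm_cross_le _ _).trans ?_
  rw [norm_coe_S2, mul_one]
  exact hq2 η

/-- The opposite of the right-hand side of the equation for the angular velocity bias. -/
def angularBiasRate (ly lD : ℝ) (yh Dh y D : S2 → ℝ) : E3 :=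
  ∫ η : S2, ((ly * (yh η - y η)) • cross (sphereGrad yh η) η
    + (lD * (Dh η - D η)) • cross (sphereGrad Dh η) η) ∂sphereMeasure

/-- The opposite of the right-hand side of the equation for the linear velocity bias. -/
def linearBiasRate (ly lD : ℝ) (yh Dh y D : S2 → ℝ) : E3 :=
  ∫ η : S2, ((lD * (Dh η - D η)) • (η : E3)
    + (ly * (yh η - y η)) • ((1 / D η) • cross η (cross η (sphereGrad yh η)))
    + (lD * (Dh η - D η)) • ((1 / D η) • cross η (cross η (sphereGrad Dh η)))) ∂sphereMeasure

variable {ly lD : ℝ} {yh' Dh' y' D' yh Dh y D : S2 → ℝ}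

theorem angularBiasRate_eq (hyh : SphereC1 yh) (hDh : SphereC1 Dh) (hy : SphereC1 y)
    (hD : SphereC1 D) :
    angularBiasRate ly lD yh Dh y D =
      ly • (∫ η : S2, (yh η - y η) • cross (sphereGrad yh η) η ∂sphereMeasure)
        + lD • ∫ η : S2, (Dh η - D η) • cross (sphereGrad Dh η) η ∂sphereMeasure := by
  have i1 := continuous_integrable (hyh.continuous_cross_grad hy)
  have i2 := continuous_integrable (hDh.continuous_cross_grad hD)
  have e := integral_add (i1.smul ly) (i2.smul lD)
  simp only [Pi.smul_apply, integral_smul] at e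
  rw [← e, angularBiasRate]
  simp only [smul_smul]

theorem linearBiasRate_eq (hyh : SphereC1 yh) (hDh : SphereC1 Dh) (hy : SphereC1 y)
    (hD : SphereC1 D) (hD0 : ∀ η, D η ≠ 0) :
    linearBiasRate ly lD yh Dh y D =
      lD • (∫ η : S2, (Dh η - D η) • (η : E3) ∂sphereMeasure)
        - ly • (∫ η : S2, ((D η)⁻¹ * (yh η - y η)) • sphereGrad yh η ∂sphereMeasure)
        - lD • ∫ η : S2, ((D η)⁻¹ * (Dh η - D η)) • sphereGrad Dh η ∂sphereMeasure := by
  have i0 : Integrable (fun η : S2 => (Dh η - D η) • (η : E3)) sphereMeasure :=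
    continuous_integrable ((hDh.sub hD).continuous.smul continuous_subtype_val)
  have i1 := continuous_integrable ((hD.inv hD0).continuous_weighted_grad hyh hy)
  have i2 := continuous_integrable ((hD.inv hD0).continuous_weighted_grad hDh hD)
  have e1 := integral_sub (i0.smul lD) (i1.smul ly)
  have e2 := integral_sub ((i0.smul lD).sub (i1.smul ly)) (i2.smul lD)
  simp only [Pi.sub_apply, Pi.smul_apply, integral_smul] at e1 e2
  rw [← e1, ← e2, linearBiasRate]
  refine integral_congr_ae (Eventually.of_forall fun η => ?_)
  simp only [cross_cross_of_dot_eq_zero η (dot_sphereGrad_self _ η),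
    one_div]
  module

theorem norm_angularBiasRate_sub_le (hy : CloseFields M B yh' y' yh y)
    (hD : CloseFields M B Dh' D' Dh D) (hM : 1 ≤ M) (hB : 0 ≤ B) (hB1 : B ≤ 1) (hly : 0 ≤ ly)
    (hlD : 0 ≤ lD) :
    ‖angularBiasRate ly lD yh' Dh' y' D' - angularBiasRate ly lD yh Dh y D‖ ≤
      (ly + lD) * (8 * M ^ 3 * B * sphereMeasure.real univ) := by
  rw [angularBiasRate_eq hy.f'_C1 hD.f'_C1 hy.g'_C1 hD.g'_C1,
    angularBiasRate_eq hy.f_C1 hD.f_C1 hy.g_C1 hD.g_C1, add_sub_add_comm, ← smul_sub, ← smul_sub,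
    add_mul]
  refine (norm_add_le _ _).trans ?_
  rw [norm_smul, norm_smul, Real.norm_of_nonneg hly, Real.norm_of_nonneg hlD]
  gcongr
  exacts [hy.norm_integral_cross_grad_sub_le hM hB hB1, hD.norm_integral_cross_grad_sub_le hM hB hB1]

theorem norm_linearBiasRate_sub_le (hy : CloseFields M B yh' y' yh y)
    (hD : CloseFields M B Dh' D' Dh D)
    (hw : CloseWeights M B (fun η => (D' η)⁻¹) fun η => (D η)⁻¹) (hD'0 : ∀ η, D' η ≠ 0)
    (hD0 : ∀ η, D η ≠ 0) (hM : 1 ≤ M) (hB : 0 ≤ B) (hB1 : B ≤ 1) (hly : 0 ≤ ly) (hlD : 0 ≤ lD) :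
    ‖linearBiasRate ly lD yh' Dh' y' D' - linearBiasRate ly lD yh Dh y D‖ ≤
      (ly + 2 * lD) * (15 * M ^ 3 * B * sphereMeasure.real univ) := by
  have hsub : ∀ a b c a' b' c' : E3, (lD • a - ly • b - lD • c) - (lD • a' - ly • b' - lD • c') =
      lD • (a - a') - ly • (b - b') - lD • (c - c') := fun a b c a' b' c' => by module
  rw [linearBiasRate_eq hy.f'_C1 hD.f'_C1 hy.g'_C1 hD.g'_C1 hD'0,
    linearBiasRate_eq hy.f_C1 hD.f_C1 hy.g_C1 hD.g_C1 hD0, hsub]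
  have i0 : Integrable (fun η : S2 => (Dh' η - D' η) • (η : E3)) sphereMeasure :=
    continuous_integrable ((hD.f'_C1.sub hD.g'_C1).continuous.smul continuous_subtype_val)
  have i1 : Integrable (fun η : S2 => (Dh η - D η) • (η : E3)) sphereMeasure :=
    continuous_integrable ((hD.f_C1.sub hD.g_C1).continuous.smul continuous_subtype_val)
  have h0 : ‖(∫ η : S2, (Dh' η - D' η) • (η : E3) ∂sphereMeasure)
      - ∫ η : S2, (Dh η - D η) • (η : E3) ∂sphereMeasure‖ ≤
      15 * M ^ 3 * B * sphereMeasure.real univ := by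
    rw [← integral_sub i0 i1]
    refine norm_integral_sphere_le fun η => ?_
    have hM3 : B ≤ M ^ 3 * B := le_mul_of_one_le_left hB (one_le_pow₀ hM)
    rw [← sub_smul, norm_smul, norm_coe_S2, mul_one, Real.norm_eq_abs]
    have h1 := abs_le.1 (hD.f_close η)
    have h2 := abs_le.1 (hD.g_close η)
    rw [abs_le]
    constructor <;> linarith
  have h1 := hy.norm_integral_weighted_grad_sub_le hw hM hB hB1
  have h2 := hD.norm_integral_weighted_grad_sub_le hw hM hB hB1
  refine (norm_sub_le _ _).trans ((add_le_add (norm_sub_le _ _) le_rfl).trans ?_)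
  rw [norm_smul, norm_smul, norm_smul, Real.norm_of_nonneg hly, Real.norm_of_nonneg hlD]
  have e0 := mul_le_mul_of_nonneg_left h0 hlD
  have e1 := mul_le_mul_of_nonneg_left h1 hly
  have e2 := mul_le_mul_of_nonneg_left h2 hlD
  linarith

/-! ### First contact with a barrier -/

/-- The nonnegative function `b - u` vanishes at the end of `[0,t]`, so its left derivative there is
nonpositive. -/
theorem deriv_le_of_first_contact {u b : ℝ → ℝ} {u' b' t : ℝ} (ht : 0 < t)
    (hu : HasDerivWithinAt u u' (Ici 0) t) (hb : HasDerivAt b b' t)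
    (hle : ∀ s ∈ Icc 0 t, u s ≤ b s) (heq : u t = b t) : b' ≤ u' := by
  have hd : HasDerivAt (fun s => b s - u s) (b' - u') t := hb.sub (hu.hasDerivAt (Ici_mem_nhds ht))
  have hs := (hasDerivAt_iff_tendsto_slope_left_right.1 hd).1
  have : b' - u' ≤ 0 := by
    refine le_of_tendsto hs ?_
    filter_upwards [Ioo_mem_nhdsLT ht] with s hs
    rw [slope_def_field, heq, sub_self, sub_zero]
    exact div_nonpos_of_nonneg_of_nonpos (sub_nonneg.2 (hle s ⟨hs.1.le, hs.2.le⟩))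
      (sub_nonpos.2 hs.2.le)
  linarith

theorem le_norm_deriv_of_first_contact {P : ℝ → E3} {P' : E3} {b : ℝ → ℝ} {b' t : ℝ} (ht : 0 < t)
    (hP : HasDerivWithinAt P P' (Ici 0) t) (hb : HasDerivAt b b' t)
    (hle : ∀ s ∈ Icc 0 t, ‖P s‖ ≤ b s) (heq : ‖P t‖ = b t) (hpos : 0 < b t) : b' ≤ ‖P'‖ := by
  -- Projecting on the direction of `P t` reduces to the scalar case: `e · P ≤ ‖P‖ ≤ b`, with
  -- equality at `t`.
  set e : E3 := ‖P t‖⁻¹ • P t with he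
  have hPt : ‖P t‖ ≠ 0 := by rw [heq]; exact hpos.ne'
  have hen : ‖e‖ = 1 := by rw [he, norm_smul, norm_inv, norm_norm, inv_mul_cancel₀ hPt]
  have hu : HasDerivWithinAt (fun s => inner ℝ e (P s)) (inner ℝ e P') (Ici 0) t :=
    (innerSL ℝ e).hasFDerivAt.comp_hasDerivWithinAt t hP
  have hcs : ∀ z : E3, inner ℝ e z ≤ ‖z‖ := fun z => by
    simpa [hen] using real_inner_le_norm e z
  refine (deriv_le_of_first_contact ht hu hb (fun s hs => (hcs _).trans (hle s hs)) ?_).trans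
    (hcs P')
  rw [he, inner_smul_left, real_inner_self_eq_norm_sq, ← heq]
  simp
  field_simp

/-- A continuous function on `[0,T] × S²` that is negative at time `0` is negative, or has a
first time of contact with `0`. -/
theorem neg_or_exists_first_contact {q : ℝ × S2 → ℝ} {T : ℝ}
    (hq : ContinuousOn q (Icc 0 T ×ˢ univ)) (h0 : ∀ η, q (0, η) < 0) :
    (∀ t ∈ Icc 0 T, ∀ η, q (t, η) < 0) ∨
      ∃ t ∈ Ioc 0 T, (∀ s ∈ Icc 0 t, ∀ η, q (s, η) ≤ 0) ∧ ∃ η, q (t, η) = 0 := by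
  by_cases hneg : ∀ t ∈ Icc 0 T, ∀ η, q (t, η) < 0
  · exact Or.inl hneg
  right
  push Not at hneg
  obtain ⟨t1, ht1, η1, h1⟩ := hneg
  set K : Set (ℝ × S2) := (Icc 0 T ×ˢ univ) ∩ q ⁻¹' Ici 0 with hK
  have hKc : IsCompact K :=
    (isCompact_Icc.prod isCompact_univ).of_isClosed_subset
      (hq.preimage_isClosed_of_isClosed (isClosed_Icc.prod isClosed_univ) isClosed_Ici)
      inter_subset_left
  -- The contact time is the least time in the compact set where `q ≥ 0`.
  obtain ⟨⟨t, η⟩, ⟨⟨htT, -⟩, hpos⟩, hmin⟩ :=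
    hKc.exists_isMinOn ⟨(t1, η1), ⟨ht1, mem_univ _⟩, h1⟩ continuous_fst.continuousOn
  have htT : t ∈ Icc 0 T := htT
  have hpos : 0 ≤ q (t, η) := hpos
  have hbefore : ∀ s, 0 ≤ s → s < t → ∀ ξ, q (s, ξ) < 0 := by
    intro s hs0 hst ξ
    by_contra! h
    exact absurd (hmin (show (s, ξ) ∈ K from ⟨⟨⟨hs0, hst.le.trans htT.2⟩, mem_univ _⟩, h⟩))
      (not_le.2 hst)
  have ht0 : 0 < t := by
    refine lt_of_le_of_ne htT.1 fun h => ?_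
    subst h
    exact absurd (h0 η) (not_lt.2 hpos)
  have hat : ∀ ξ, q (t, ξ) ≤ 0 := by
    intro ξ
    have hcont : ContinuousOn (fun s => q (s, ξ)) (Icc 0 T) :=
      hq.comp (continuous_id.prodMk continuous_const).continuousOn fun s hs => ⟨hs, mem_univ _⟩
    have htend : Tendsto (fun s => q (s, ξ)) (𝓝[Ioo 0 t] t) (𝓝 (q (t, ξ))) :=
      (hcont t htT).mono_left (nhdsWithin_mono t fun s hs => ⟨hs.1.le, hs.2.le.trans htT.2⟩)
    have : (𝓝[Ioo 0 t] t).NeBot := by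
      rw [nhdsWithin_Ioo_eq_nhdsLT ht0]
      infer_instance
    exact le_of_tendsto htend (eventually_mem_nhdsWithin.mono fun s hs =>
      (hbefore s hs.1.le hs.2 ξ).le)
  refine ⟨t, ⟨ht0, htT.2⟩, fun s hs ξ => ?_, η, le_antisymm (hat η) hpos⟩
  rcases hs.2.eq_or_lt with rfl | h
  · exact hat ξ
  · exact (hbefore s hs.1 h ξ).le

end

section

/-! ### Stability of the observer -/

/-- At a point of first contact of `|u' - u|` with a barrier, the gradients of `u'` and `u` agree
and the difference of the time derivatives grows at least as fast as the barrier. -/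
theorem exists_sign_of_first_contact {u' u : ℝ → S2 → ℝ} {b : ℝ → ℝ} {A' A b' t : ℝ} {η : S2}
    (ht : 0 < t) (hu'C1 : SphereC1 (u' t)) (huC1 : SphereC1 (u t))
    (hu' : HasDerivWithinAt (fun s => u' s η) A' (Ici 0) t)
    (hu : HasDerivWithinAt (fun s => u s η) A (Ici 0) t) (hb : HasDerivAt b b' t)
    (hle : ∀ s ∈ Icc 0 t, ∀ ξ, |u' s ξ - u s ξ| ≤ b s) (heq : |u' t η - u t η| = b t) :
    ∃ σ : ℝ, |σ| = 1 ∧ σ * (u' t η - u t η) = b t ∧ b' ≤ σ * (A' - A) ∧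
      sphereGrad (u' t) η = sphereGrad (u t) η := by
  have main : ∀ σ : ℝ, |σ| = 1 → σ * (u' t η - u t η) = b t → b' ≤ σ * (A' - A) ∧
      sphereGrad (u' t) η = sphereGrad (u t) η := by
    intro σ hσ hσeq
    have hσle : ∀ s ∈ Icc 0 t, ∀ ξ, σ * (u' s ξ - u s ξ) ≤ b s := fun s hs ξ => by
      refine (le_abs_self _).trans ?_
      rw [abs_mul, hσ, one_mul]
      exact hle s hs ξ
    refine ⟨deriv_le_of_first_contact ht ((hu'.sub hu).const_mul σ) hb
      (fun s hs => hσle s hs η) hσeq, ?_⟩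
    -- The signed difference `σ (u' - u)` is maximal on the sphere at `η`, so its gradient vanishes
    -- there.
    have hg := ((sphereC1_const σ).hasSphereGrad η).mul
      ((hu'C1.hasSphereGrad η).sub (huC1.hasSphereGrad η))
    have h0 := hg.sphereGrad_eq
    rw [sphereGrad_eq_zero_of_forall_le fun ξ => ?_, sphereGrad_const, smul_zero, add_zero] at h0
    · have hσ0 : σ ≠ 0 := fun h => by simp [h] at hσ
      exact sub_eq_zero.1 ((smul_eq_zero.1 h0.symm).resolve_left hσ0)
    · rw [hσeq]
      exact hσle t ⟨ht.le, le_rfl⟩ ξ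
  rcases abs_choice (u' t η - u t η) with h | h
  · have h1 : (1 : ℝ) * (u' t η - u t η) = b t := by rw [one_mul, ← h, heq]
    exact ⟨1, abs_one, h1, main 1 abs_one h1⟩
  · have h1 : (-1 : ℝ) * (u' t η - u t η) = b t := by rw [neg_one_mul, ← h, heq]
    exact ⟨-1, by simp, h1, main (-1) (by simp) h1⟩

/-- The exponential rate at which two observers may separate. -/
def separationRate (ky kD ly lD M : ℝ) : ℝ :=
  5 * M ^ 3 + 3 + ky + kD + (ly + 2 * lD) * (15 * M ^ 3 * sphereMeasure.real univ)

/-- Two sets of measurements, of which the first is `δ`-close to the second on `[0,T]`, with the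
bounds on which the stability of the observer depends. -/
structure CloseMeasurements (T M δ : ℝ) (vm' wm' vm wm : ℝ → E3) (y' D' y D : ℝ → S2 → ℝ) :
    Prop where
  y'_C1 : FieldC1 y'
  D'_C1 : FieldC1 D'
  y_C1 : FieldC1 y
  D_C1 : FieldC1 D
  y_le : ∀ t ∈ Icc 0 T, ∀ η, |y t η| ≤ M
  D_le : ∀ t ∈ Icc 0 T, ∀ η, |D t η| ≤ M
  grad_y'_le : ∀ t ∈ Icc 0 T, ∀ η, ‖sphereGrad (y' t) η‖ ≤ M
  grad_D'_le : ∀ t ∈ Icc 0 T, ∀ η, ‖sphereGrad (D' t) η‖ ≤ M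
  D'_ne : ∀ t ∈ Icc 0 T, ∀ η, D' t η ≠ 0
  D_ne : ∀ t ∈ Icc 0 T, ∀ η, D t η ≠ 0
  weights : ∀ t ∈ Icc 0 T, CloseWeights M δ (fun η => (D' t η)⁻¹) fun η => (D t η)⁻¹
  v_close : ∀ t ∈ Icc 0 T, ‖vm' t - vm t‖ ≤ δ
  w_close : ∀ t ∈ Icc 0 T, ‖wm' t - wm t‖ ≤ δ
  y_close : ∀ t ∈ Icc 0 T, ∀ η, |y' t η - y t η| < δ
  D_close : ∀ t ∈ Icc 0 T, ∀ η, |D' t η - D t η| < δ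

variable {T ky kD ly lD M δ : ℝ} {vm' wm' vm wm : ℝ → E3} {y' D' y D : ℝ → S2 → ℝ}
  {yh' Dh' yh Dh : ℝ → S2 → ℝ} {pw' pv' pw pv : ℝ → E3}

theorem CloseMeasurements.norm_flowField_sub_le (hc : CloseMeasurements T M δ vm' wm' vm wm y' D' y D)
    (hM : 1 ≤ M) {t B : ℝ} (ht : t ∈ Icc 0 T) (hδ : 0 ≤ δ) (hδB : δ ≤ B)
    (hv : ‖vm t - pv t‖ ≤ M) (hpw : ‖pw' t - pw t‖ ≤ B) (hpv : ‖pv' t - pv t‖ ≤ B) (η : S2) :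
    ‖flowField (wm' t - pw' t) (vm' t - pv' t) (D' t η) η
      - flowField (wm t - pw t) (vm t - pv t) (D t η) η‖ ≤ 5 * M ^ 2 * B := by
  have h2 : ∀ a b c d : E3, ‖a - c‖ ≤ δ → ‖b - d‖ ≤ B → ‖(a - b) - (c - d)‖ ≤ 2 * B :=
    fun a b c d h1 h2 => by
      rw [sub_sub_sub_comm]
      refine (norm_sub_le _ _).trans (by linarith)
  have hB : 0 ≤ B := hδ.trans hδB
  have hM0 : 0 ≤ M := by linarith
  refine (BiasObserver.norm_flowField_sub_le _ _ _ _ _ _ η).trans ?_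
  simp only [one_div]
  have e1 := h2 _ _ _ _ (hc.w_close t ht) hpw
  have e2 : |(D' t η)⁻¹| * ‖(vm' t - pv' t) - (vm t - pv t)‖ ≤ M * (2 * B) :=
    mul_le_mul ((hc.weights t ht).a'_le η) (h2 _ _ _ _ (hc.v_close t ht) hpv) (norm_nonneg _) hM0
  have e3 : |(D' t η)⁻¹ - (D t η)⁻¹| * ‖vm t - pv t‖ ≤ (M * B) * M := by
    refine mul_le_mul (((hc.weights t ht).a_close η).trans ?_) hv (norm_nonneg _) (by positivity)
    gcongr
  have e4 : B ≤ M * B := le_mul_of_one_le_left hB hM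
  have e5 : M * B ≤ M * (M * B) := le_mul_of_one_le_left (by positivity) hM
  linarith

theorem mul_le_of_abs_eq_one {σ x C : ℝ} (hσ : |σ| = 1) (hx : |x| ≤ C) : σ * x ≤ C := by
  refine (le_abs_self _).trans ?_
  rwa [abs_mul, hσ, one_mul]

theorem CloseWeights.mono {B B' : ℝ} {a' a : S2 → ℝ} (h : CloseWeights M B a' a) (hM : 0 ≤ M)
    (hB : B ≤ B') : CloseWeights M B' a' a :=
  { h with a_close := fun η => (h.a_close η).trans (mul_le_mul_of_nonneg_left hB hM) }

/-- Stability of the observer: the distance between the solutions for two close sets of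
measurements grows at most exponentially, as long as it is at most `1`. -/
theorem IsObserverSolution.dist_lt
    (hobs' : IsObserverSolution ky kD ly lD vm' wm' y' D' yh' Dh' pw' pv')
    (hobs : IsObserverSolution ky kD ly lD vm wm y D yh Dh pw pv)
    (hky : 0 ≤ ky) (hkD : 0 ≤ kD) (hly : 0 ≤ ly) (hlD : 0 ≤ lD) (hM : 1 ≤ M) (hδ : 0 < δ)
    (hc : CloseMeasurements T M δ vm' wm' vm wm y' D' y D)
    (hyh : ∀ t ∈ Icc 0 T, ∀ η, |yh t η| ≤ M) (hDh : ∀ t ∈ Icc 0 T, ∀ η, |Dh t η| ≤ M)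
    (hgy : ∀ t ∈ Icc 0 T, ∀ η, ‖sphereGrad (yh t) η‖ ≤ M)
    (hgD : ∀ t ∈ Icc 0 T, ∀ η, ‖sphereGrad (Dh t) η‖ ≤ M)
    (hv : ∀ t ∈ Icc 0 T, ‖vm t - pv t‖ ≤ M)
    (hpw0 : ‖pw' 0 - pw 0‖ < δ) (hpv0 : ‖pv' 0 - pv 0‖ < δ)
    (hδT : δ * Real.exp (separationRate ky kD ly lD M * T) ≤ 1) :
    ∀ t ∈ Icc 0 T, ∀ η,
      max (max ‖pw' t - pw t‖ ‖pv' t - pv t‖) (max |yh' t η - yh t η| |Dh' t η - Dh t η|) <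
        δ * Real.exp (separationRate ky kD ly lD M * t) := by
  set K := separationRate ky kD ly lD M with hK
  set b : ℝ → ℝ := fun t => δ * Real.exp (K * t) with hb
  rcases lt_or_ge T 0 with hT | hT
  · intro t ht
    exact absurd (ht.1.trans ht.2) (not_le.2 hT)
  have hσ0 : 0 ≤ sphereMeasure.real univ := measureReal_nonneg
  have hM0 : 0 ≤ M := by linarith
  have hM3 : 0 ≤ M ^ 3 := by positivity
  have hK0 : 0 ≤ K := by rw [hK, separationRate]; positivity
  have hbd : ∀ t, HasDerivAt b (K * b t) t := fun t => by
    have := (((hasDerivAt_id t).const_mul K).exp).const_mul δ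
    convert! this using 1
    simp only [hb, id, mul_one]
    ring
  have hbpos : ∀ t, 0 < b t := fun t => mul_pos hδ (Real.exp_pos _)
  have hbδ : ∀ t, 0 ≤ t → δ ≤ b t := fun t ht =>
    le_mul_of_one_le_right hδ.le (Real.one_le_exp (mul_nonneg hK0 ht))
  -- The estimates on the bias rates hold only for distances at most `1`.
  have hb1 : ∀ t ≤ T, b t ≤ 1 := fun t ht => by
    refine le_trans ?_ hδT
    simp only [hb]
    gcongr
  let q : ℝ × S2 → ℝ := fun p =>
    max (max ‖pw' p.1 - pw p.1‖ ‖pv' p.1 - pv p.1‖)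
      (max |yh' p.1 p.2 - yh p.1 p.2| |Dh' p.1 p.2 - Dh p.1 p.2|) - b p.1
  have hsub : Icc 0 T ×ˢ (univ : Set S2) ⊆ Ici (0 : ℝ) ×ˢ univ :=
    prod_mono (fun t ht => ht.1) le_rfl
  have hfst : ∀ {u : ℝ → E3}, ContDiffOn ℝ 1 u (Ici 0) →
      ContinuousOn (fun p : ℝ × S2 => u p.1) (Icc 0 T ×ˢ univ) := fun {u} hu =>
    hu.continuousOn.comp continuous_fst.continuousOn fun p hp => (hsub hp).1
  have hfield : ∀ {u : ℝ → S2 → ℝ}, FieldC1 u →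
      ContinuousOn (fun p : ℝ × S2 => u p.1 p.2) (Icc 0 T ×ˢ univ) := fun hu =>
    hu.continuousOn.mono hsub
  have hbc : Continuous b := continuous_iff_continuousAt.2 fun t => (hbd t).continuousAt
  have hq : ContinuousOn q (Icc 0 T ×ˢ univ) := by
    refine ContinuousOn.sub ?_ (hbc.comp continuous_fst).continuousOn
    exact ContinuousOn.sup
      (ContinuousOn.sup ((hfst hobs'.pwh_C1).sub (hfst hobs.pwh_C1)).norm
        ((hfst hobs'.pvh_C1).sub (hfst hobs.pvh_C1)).norm)
      (ContinuousOn.sup ((hfield hobs'.yh_C1).sub (hfield hobs.yh_C1)).abs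
        ((hfield hobs'.Dh_C1).sub (hfield hobs.Dh_C1)).abs)
  have hT0 : (0 : ℝ) ∈ Icc 0 T := ⟨le_rfl, hT⟩
  -- Both observers start from their measured fields, so the initial gap of the estimates is that of
  -- the measurements, strictly below `δ = b 0`.
  have hq0 : ∀ η, q (0, η) < 0 := fun η => by
    have hb0 : b 0 = δ := by simp [hb]
    simp only [q, hb0, hobs'.init_yh, hobs.init_yh, hobs'.init_Dh, hobs.init_Dh]
    exact sub_neg.2 (max_lt (max_lt hpw0 hpv0)
      (max_lt (hc.y_close 0 hT0 η) (hc.D_close 0 hT0 η)))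
  rcases neg_or_exists_first_contact hq hq0 with h | ⟨t, ht, hle, η, heq⟩
  · exact fun t ht η => sub_neg.1 (h t ht η)
  exfalso
  have htT : t ∈ Icc 0 T := ⟨ht.1.le, ht.2⟩
  have hlew : ∀ s ∈ Icc 0 t, ‖pw' s - pw s‖ ≤ b s := fun s hs =>
    (le_max_left _ _).trans ((le_max_left _ _).trans (sub_nonpos.1 (hle s hs η)))
  have hlev : ∀ s ∈ Icc 0 t, ‖pv' s - pv s‖ ≤ b s := fun s hs =>
    (le_max_right _ _).trans ((le_max_left _ _).trans (sub_nonpos.1 (hle s hs η)))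
  have hley : ∀ s ∈ Icc 0 t, ∀ ξ, |yh' s ξ - yh s ξ| ≤ b s := fun s hs ξ =>
    (le_max_left _ _).trans ((le_max_right _ _).trans (sub_nonpos.1 (hle s hs ξ)))
  have hleD : ∀ s ∈ Icc 0 t, ∀ ξ, |Dh' s ξ - Dh s ξ| ≤ b s := fun s hs ξ =>
    (le_max_right _ _).trans ((le_max_right _ _).trans (sub_nonpos.1 (hle s hs ξ)))
  have htt : t ∈ Icc 0 t := ⟨ht.1.le, le_rfl⟩
  have hB := hbpos t
  have hδB := hbδ t ht.1.le
  have hyc : CloseFields M (b t) (yh' t) (y' t) (yh t) (y t) :=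
    { f'_C1 := hobs'.yh_C1.sphereC1 htT.1
      g'_C1 := hc.y'_C1.sphereC1 htT.1
      f_C1 := hobs.yh_C1.sphereC1 htT.1
      g_C1 := hc.y_C1.sphereC1 htT.1
      f_le := hyh t htT
      g_le := hc.y_le t htT
      grad_f_le := hgy t htT
      grad_g'_le := hc.grad_y'_le t htT
      f_close := hley t htt
      g_close := fun ξ => (hc.y_close t htT ξ).le.trans hδB }
  have hDc : CloseFields M (b t) (Dh' t) (D' t) (Dh t) (D t) :=
    { f'_C1 := hobs'.Dh_C1.sphereC1 htT.1
      g'_C1 := hc.D'_C1.sphereC1 htT.1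
      f_C1 := hobs.Dh_C1.sphereC1 htT.1
      g_C1 := hc.D_C1.sphereC1 htT.1
      f_le := hDh t htT
      g_le := hc.D_le t htT
      grad_f_le := hgD t htT
      grad_g'_le := hc.grad_D'_le t htT
      f_close := hleD t htt
      g_close := fun ξ => (hc.D_close t htT ξ).le.trans hδB }
  -- Each summand of the rate pays for one kind of contact: `5 M³` for the flow, the last term for
  -- the biases. Of `3`, two units pay for the linear velocity in the depth equation, and the
  -- remaining one makes every inequality strict.
  have hKB : K * b t = 5 * M ^ 3 * b t + 3 * b t + ky * b t + kD * b t +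
      (ly + 2 * lD) * (15 * M ^ 3 * b t * sphereMeasure.real univ) := by
    rw [hK, separationRate]
    ring
  have p0 : 0 ≤ M ^ 3 * b t := by positivity
  have p1 : 0 ≤ M ^ 3 * b t * sphereMeasure.real univ := by positivity
  have p2 : 0 ≤ ky * b t := by positivity
  have p3 : 0 ≤ kD * b t := by positivity
  have p4 : 0 ≤ ly * (M ^ 3 * b t * sphereMeasure.real univ) := by positivity
  have p5 : 0 ≤ lD * (M ^ 3 * b t * sphereMeasure.real univ) := by positivity
  have hflow := hc.norm_flowField_sub_le (pw := pw) (pw' := pw') (pv := pv) (pv' := pv') hM htT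
    hδ.le hδB (hv t htT) (hlew t htt) (hlev t htt) η
  have hdot : ∀ g : E3, ‖g‖ ≤ M →
      |dot g (flowField (wm t - pw t) (vm t - pv t) (D t η) η)
        - dot g (flowField (wm' t - pw' t) (vm' t - pv' t) (D' t η) η)| ≤ 5 * M ^ 3 * b t := by
    intro g hg
    rw [abs_sub_comm, dot, dot, ← inner_sub_right]
    refine (abs_real_inner_le_norm _ _).trans ((mul_le_mul hg hflow (norm_nonneg _) hM0).trans ?_)
    linarith
  have hcase : ‖pw' t - pw t‖ = b t ∨ ‖pv' t - pv t‖ = b t ∨ |yh' t η - yh t η| = b t ∨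
      |Dh' t η - Dh t η| = b t := by
    by_contra! hne
    exact absurd heq (ne_of_lt (sub_neg.2 (max_lt
      (max_lt (lt_of_le_of_ne (hlew t htt) hne.1) (lt_of_le_of_ne (hlev t htt) hne.2.1))
      (max_lt (lt_of_le_of_ne (hley t htt η) hne.2.2.1)
        (lt_of_le_of_ne (hleD t htt η) hne.2.2.2)))))
  rcases hcase with h | h | h | h
  · have h1 := le_norm_deriv_of_first_contact ht.1
      ((hobs'.eq_pwh t htT.1).sub (hobs.eq_pwh t htT.1)) (hbd t) hlew h hB
    have h2 := norm_angularBiasRate_sub_le hyc hDc hM hB.le (hb1 t ht.2) hly hlD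
    simp only [angularBiasRate] at h2
    rw [neg_sub_neg, norm_sub_rev] at h1
    linarith
  · have h1 := le_norm_deriv_of_first_contact ht.1
      ((hobs'.eq_pvh t htT.1).sub (hobs.eq_pvh t htT.1)) (hbd t) hlev h hB
    have h2 := norm_linearBiasRate_sub_le hyc hDc ((hc.weights t htT).mono hM0 hδB)
      (hc.D'_ne t htT) (hc.D_ne t htT) hM hB.le (hb1 t ht.2) hly hlD
    simp only [linearBiasRate] at h2
    rw [neg_sub_neg, norm_sub_rev] at h1
    linarith
  · obtain ⟨σ, hσ, hσeq, hder, hgrad⟩ := exists_sign_of_first_contact ht.1 hyc.f'_C1 hyc.f_C1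
      (hobs'.eq_yh t htT.1 η) (hobs.eq_yh t htT.1 η) (hbd t) hley h
    -- The uncontrolled gradient is replaced by that of the limit estimate. The gain term then gives
    -- at most `ky δ`-type errors bounded by `ky * b t`, minus the damping `ky * b t`.
    rw [hgrad] at hder
    have h1 := mul_le_of_abs_eq_one hσ (hdot _ (hgy t htT η))
    have h2 := mul_le_mul_of_nonneg_left (mul_le_of_abs_eq_one hσ (hyc.g_close η)) hky
    have h3 : ky * (σ * (yh' t η - yh t η)) = ky * b t := by rw [hσeq]
    linarith
  · obtain ⟨σ, hσ, hσeq, hder, hgrad⟩ := exists_sign_of_first_contact ht.1 hDc.f'_C1 hDc.f_C1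
      (hobs'.eq_Dh t htT.1 η) (hobs.eq_Dh t htT.1 η) (hbd t) hleD h
    rw [hgrad] at hder
    have h1 := mul_le_of_abs_eq_one hσ (hdot _ (hgD t htT η))
    have h2 := mul_le_mul_of_nonneg_left (mul_le_of_abs_eq_one hσ (hDc.g_close η)) hkD
    have h3 : kD * (σ * (Dh' t η - Dh t η)) = kD * b t := by rw [hσeq]
    have h4 : |dot (vm t - pv t) η - dot (vm' t - pv' t) η| ≤ 2 * b t := by
      rw [dot, dot, ← inner_sub_left]
      refine (abs_real_inner_le_norm _ _).trans ?_
      rw [norm_coe_S2, mul_one, norm_sub_rev, sub_sub_sub_comm]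
      exact (norm_sub_le _ _).trans (by linarith [hc.v_close t htT, hlev t htt])
    have h5 := mul_le_of_abs_eq_one hσ h4
    linarith

/-! ### From two observers to a convergent sequence -/

theorem closeWeights_inv {D' D : S2 → ℝ} {C d : ℝ} (hD' : SphereC1 D') (hD : SphereC1 D)
    (hd : 0 < d) (hD'd : ∀ η, d ≤ D' η) (hDd : ∀ η, d ≤ D η)
    (hgrad : ∀ η, ‖sphereGrad D' η‖ ≤ C) (hclose : ∀ η, |D' η - D η| ≤ δ)
    (h1 : d⁻¹ ≤ M) (h2 : (d ^ 2)⁻¹ ≤ M) (h3 : (d ^ 2)⁻¹ * C ≤ M) :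
    CloseWeights M δ (fun η => (D' η)⁻¹) fun η => (D η)⁻¹ := by
  have hp' : ∀ η, 0 < D' η := fun η => hd.trans_le (hD'd η)
  have hp : ∀ η, 0 < D η := fun η => hd.trans_le (hDd η)
  refine ⟨hD'.inv fun η => (hp' η).ne', hD.inv fun η => (hp η).ne', fun η => ?_, fun η => ?_,
    fun η => ?_⟩
  · rw [abs_inv, abs_of_pos (hp' η)]
    exact (inv_anti₀ hd (hD'd η)).trans h1
  · rw [((hD'.hasSphereGrad η).inv (hp' η).ne').sphereGrad_eq, norm_neg, norm_smul,
      Real.norm_of_nonneg (by positivity)]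
    refine le_trans ?_ h3
    gcongr
    · exact hD'd η
    · exact hgrad η
  · have hδ : 0 ≤ δ := (abs_nonneg _).trans (hclose η)
    have e : (D' η)⁻¹ - (D η)⁻¹ = (D' η * D η)⁻¹ * -(D' η - D η) := by
      have := (hp' η).ne'
      have := (hp η).ne'
      field_simp
      ring
    rw [e, abs_mul, abs_neg, abs_of_pos (inv_pos.2 (mul_pos (hp' η) (hp η)))]
    refine mul_le_mul ?_ (hclose η) (abs_nonneg _) ((inv_nonneg.2 (sq_nonneg d)).trans h2)
    refine le_trans ?_ h2
    rw [sq]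
    exact inv_anti₀ (mul_pos hd hd) (mul_le_mul (hD'd η) (hDd η) hd.le (hp' η).le)

theorem exists_bound_vec {u : ℝ → E3} (hu : ContinuousOn u (Ici 0)) (T : ℝ) :
    ∃ C, ∀ t ∈ Icc 0 T, ‖u t‖ ≤ C :=
  isCompact_Icc.exists_bound_of_continuousOn (hu.mono fun _ ht => ht.1)

theorem eventually_norm_sub_lt_of_tendstoC0Vec {un : ℕ → ℝ → E3} {u : ℝ → E3}
    (h : TendstoC0Vec T un u) (hδ : 0 < δ) :
    ∀ᶠ n in atTop, ∀ t ∈ Icc 0 T, ‖un n t - u t‖ < δ := by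
  filter_upwards [Metric.tendstoUniformlyOn_iff.1 h δ hδ] with n hn t ht
  rw [← dist_eq_norm, dist_comm]
  exact hn t ht

theorem eventually_abs_sub_lt_of_tendstoC0Field {un : ℕ → ℝ → S2 → ℝ} {u : ℝ → S2 → ℝ}
    (h : TendstoC0Field T un u) (hδ : 0 < δ) :
    ∀ᶠ n in atTop, ∀ t ∈ Icc 0 T, ∀ η, |un n t η - u t η| < δ := by
  filter_upwards [Metric.tendstoUniformlyOn_iff.1 h δ hδ] with n hn t ht η
  rw [← Real.dist_eq, dist_comm]
  exact hn (t, η) ⟨ht, mem_univ _⟩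

/-- The observer solutions converge to that of the limit data, uniformly on `[0,T]`. -/
theorem eventually_observer_dist_lt (hky : 0 ≤ ky) (hkD : 0 ≤ kD) (hly : 0 ≤ ly) (hlD : 0 ≤ lD)
    (pv pw : E3)
    (vn wn : ℕ → ℝ → E3) (v w : ℝ → E3)
    (yn Dn : ℕ → ℝ → S2 → ℝ) (y D : ℝ → S2 → ℝ)
    (hdatan : ∀ n, IsData pv pw (vn n) (wn n) (yn n) (Dn n))
    (hdata : IsData pv pw v w y D)
    (hv : TendstoC0Vec T vn v) (hw : TendstoC0Vec T wn w)
    (hbound : ∃ M : ℝ, ∀ n, FieldC1Bound (yn n) (Icc 0 T) M ∧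
      FieldC1Bound (Dn n) (Icc 0 T) M)
    (hy : TendstoC0Field T yn y) (hD : TendstoC0Field T Dn D)
    (yhn Dhn : ℕ → ℝ → S2 → ℝ) (pwhn pvhn : ℕ → ℝ → E3)
    (yh Dh : ℝ → S2 → ℝ) (pwh pvh : ℝ → E3)
    (hobsn : ∀ n, IsObserverSolution ky kD ly lD
      (fun t => vn n t + pv) (fun t => wn n t + pw) (yn n) (Dn n)
      (yhn n) (Dhn n) (pwhn n) (pvhn n))
    (hobs : IsObserverSolution ky kD ly lD
      (fun t => v t + pv) (fun t => w t + pw) y D yh Dh pwh pvh)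
    (hpw0 : Tendsto (fun n => pwhn n 0) atTop (𝓝 (pwh 0)))
    (hpv0 : Tendsto (fun n => pvhn n 0) atTop (𝓝 (pvh 0))) :
    ∀ ε > 0, ∀ᶠ n in atTop, ∀ t ∈ Icc 0 T, ∀ η : S2,
      max (max ‖pwhn n t - pwh t‖ ‖pvhn n t - pvh t‖)
        (max |yhn n t η - yh t η| |Dhn n t η - Dh t η|) < ε := by
  obtain ⟨C0, hC0⟩ := hbound
  obtain ⟨d, hd, hDd⟩ := hdata.D_pos
  obtain ⟨C1, hC1⟩ := exists_bound_field hobs.yh_C1.continuousOn T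
  obtain ⟨C2, hC2⟩ := exists_bound_field hobs.Dh_C1.continuousOn T
  obtain ⟨C3, hC3⟩ := exists_bound_field hobs.yh_C1.continuousOn_sphereGrad T
  obtain ⟨C4, hC4⟩ := exists_bound_field hobs.Dh_C1.continuousOn_sphereGrad T
  obtain ⟨C5, hC5⟩ := exists_bound_field hdata.y_C1b.1.continuousOn T
  obtain ⟨C6, hC6⟩ := exists_bound_field hdata.D_C1b.1.continuousOn T
  obtain ⟨C7, hC7⟩ := exists_bound_vec
    ((hdata.v_C1b.1.continuousOn.add continuousOn_const).sub hobs.pvh_C1.continuousOn :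
      ContinuousOn (fun t => v t + pv - pvh t) (Ici 0)) T
  obtain ⟨M, hM, hM0, hM1, hM2, hM3, hM4, hM5, hM6, hM7, hd1, hd2, hd3⟩ :
      ∃ M : ℝ, 1 ≤ M ∧ C0 ≤ M ∧ C1 ≤ M ∧ C2 ≤ M ∧ C3 ≤ M ∧ C4 ≤ M ∧ C5 ≤ M ∧ C6 ≤ M ∧ C7 ≤ M ∧
        (d / 2)⁻¹ ≤ M ∧ ((d / 2) ^ 2)⁻¹ ≤ M ∧ ((d / 2) ^ 2)⁻¹ * C0 ≤ M := by
    -- Finitely many lower bounds hold for all large `M`. This choice precedes that of `K` and `δ`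
    -- and involves neither `n` nor `ε`.
    have h := fun c : ℝ => eventually_ge_atTop c
    exact ((h 1).and ((h C0).and ((h C1).and ((h C2).and ((h C3).and ((h C4).and ((h C5).and
      ((h C6).and ((h C7).and ((h _).and ((h _).and (h _)))))))))))).exists
  intro ε hε
  set K := separationRate ky kD ly lD M with hK
  have hK0 : 0 ≤ K := by
    have : 0 ≤ sphereMeasure.real univ := measureReal_nonneg
    rw [hK, separationRate]
    positivity
  -- With this `δ` the barrier ends at `min ε 1`: below `ε` for the conclusion, below `1` for the
  -- stability estimate.
  set δ : ℝ := min ε 1 * Real.exp (-(K * T)) with hδdef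
  have hδ : 0 < δ := mul_pos (lt_min hε one_pos) (Real.exp_pos _)
  have hδT : δ * Real.exp (K * T) = min ε 1 := by
    rw [hδdef, mul_assoc, ← Real.exp_add]
    simp
  have e1 := eventually_norm_sub_lt_of_tendstoC0Vec hv hδ
  have e2 := eventually_norm_sub_lt_of_tendstoC0Vec hw hδ
  have e3 := eventually_abs_sub_lt_of_tendstoC0Field hy hδ
  have e4 := eventually_abs_sub_lt_of_tendstoC0Field hD hδ
  -- The positive lower bounds on the `Dn` may depend on `n`. Uniform convergence supplies the
  -- common bound `d / 2` for large `n`.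
  have e5 := eventually_abs_sub_lt_of_tendstoC0Field hD (half_pos hd)
  have e6 := Metric.tendsto_nhds.1 hpw0 δ hδ
  have e7 := Metric.tendsto_nhds.1 hpv0 δ hδ
  filter_upwards [e1, e2, e3, e4, e5, e6, e7] with n h1 h2 h3 h4 h5 h6 h7
  rw [dist_eq_norm] at h6 h7
  have hDnd : ∀ t ∈ Icc 0 T, ∀ η, d / 2 ≤ Dn n t η := fun t ht η => by
    linarith [(abs_lt.1 (h5 t ht η)).1, hDd t ht.1 η]
  have hDd2 : ∀ t ∈ Icc 0 T, ∀ η, d / 2 ≤ D t η := fun t ht η => by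
    linarith [hDd t ht.1 η]
  have hc : CloseMeasurements T M δ (fun t => vn n t + pv) (fun t => wn n t + pw)
      (fun t => v t + pv) (fun t => w t + pw) (yn n) (Dn n) y D :=
    { y'_C1 := (hdatan n).y_C1b.1
      D'_C1 := (hdatan n).D_C1b.1
      y_C1 := hdata.y_C1b.1
      D_C1 := hdata.D_C1b.1
      y_le := fun t ht η => (hC5 t ht η).trans hM5
      D_le := fun t ht η => (hC6 t ht η).trans hM6
      grad_y'_le := fun t ht η => ((hC0 n).1 t ht η).2.2.trans hM0
      grad_D'_le := fun t ht η => ((hC0 n).2 t ht η).2.2.trans hM0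
      D'_ne := fun t ht η => ((half_pos hd).trans_le (hDnd t ht η)).ne'
      D_ne := fun t ht η => ((half_pos hd).trans_le (hDd2 t ht η)).ne'
      weights := fun t ht => closeWeights_inv ((hdatan n).D_C1b.1.sphereC1 ht.1)
        (hdata.D_C1b.1.sphereC1 ht.1) (half_pos hd) (hDnd t ht) (hDd2 t ht)
        (fun η => ((hC0 n).2 t ht η).2.2) (fun η => (h4 t ht η).le) hd1 hd2 hd3
      v_close := fun t ht => by simpa using (h1 t ht).le
      w_close := fun t ht => by simpa using (h2 t ht).le
      y_close := h3
      D_close := h4 }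
  intro t ht η
  refine ((hobsn n).dist_lt hobs hky hkD hly hlD hM hδ hc
    (fun t ht η => (hC1 t ht η).trans hM1) (fun t ht η => (hC2 t ht η).trans hM2)
    (fun t ht η => (hC3 t ht η).trans hM3) (fun t ht η => (hC4 t ht η).trans hM4)
    (fun t ht => (hC7 t ht).trans hM7) h6 h7 (hδT.trans_le (min_le_right _ _)) t ht η).trans_le ?_
  calc δ * Real.exp (K * t) ≤ δ * Real.exp (K * T) := by
        gcongr
        exact ht.2
    _ ≤ ε := hδT.trans_le (min_le_left _ _)

end

end BiasObserver

end

theorem mainTheorem4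
    (T : ℝ) (hT : 0 < T)
    (ky kD ly lD : ℝ) (hky : 0 < ky) (hkD : 0 < kD) (hly : 0 < ly) (hlD : 0 < lD)
    (pv pw : BiasObserver.E3)
    -- the sequence of data and the limit data
    (vn wn : ℕ → ℝ → BiasObserver.E3) (v w : ℝ → BiasObserver.E3)
    (yn Dn : ℕ → ℝ → BiasObserver.S2 → ℝ) (y D : ℝ → BiasObserver.S2 → ℝ)
    (hdatan : ∀ n, BiasObserver.IsData pv pw (vn n) (wn n) (yn n) (Dn n))
    (hdata : BiasObserver.IsData pv pw v w y D)
    (hv : BiasObserver.TendstoC0Vec T vn v) (hw : BiasObserver.TendstoC0Vec T wn w)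
    (hbound : ∃ M : ℝ, ∀ n, BiasObserver.FieldC1Bound (yn n) (Icc 0 T) M ∧
      BiasObserver.FieldC1Bound (Dn n) (Icc 0 T) M)
    (hy : BiasObserver.TendstoC0Field T yn y) (hD : BiasObserver.TendstoC0Field T Dn D)
    -- the associated observer solutions
    (yhn Dhn : ℕ → ℝ → BiasObserver.S2 → ℝ) (pwhn pvhn : ℕ → ℝ → BiasObserver.E3)
    (yh Dh : ℝ → BiasObserver.S2 → ℝ) (pwh pvh : ℝ → BiasObserver.E3)
    (hobsn : ∀ n, BiasObserver.IsObserverSolution ky kD ly lD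
      (fun t => vn n t + pv) (fun t => wn n t + pw) (yn n) (Dn n)
      (yhn n) (Dhn n) (pwhn n) (pvhn n))
    (hobs : BiasObserver.IsObserverSolution ky kD ly lD
      (fun t => v t + pv) (fun t => w t + pw) y D yh Dh pwh pvh)
    (hpw0 : Tendsto (fun n => pwhn n 0) atTop (𝓝 (pwh 0)))
    (hpv0 : Tendsto (fun n => pvhn n 0) atTop (𝓝 (pvh 0))) :
    (BiasObserver.TendstoC0Vec T pwhn pwh ∧ BiasObserver.TendstoC0Vec T pvhn pvh) ∧
    (BiasObserver.TendstoC0Field T yhn yh ∧ BiasObserver.TendstoC0Field T Dhn Dh) := by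
  have key := BiasObserver.eventually_observer_dist_lt hky.le hkD.le hly.le hlD.le pv pw vn wn v w
    yn Dn y D hdatan hdata hv hw hbound hy hD yhn Dhn pwhn pvhn yh Dh pwh pvh hobsn hobs hpw0 hpv0
  -- The bound on the biases is stated at each point of the sphere, so some point is needed to
  -- extract it.
  have η₀ : BiasObserver.S2 := BiasObserver.radialProj 0
  refine ⟨⟨?_, ?_⟩, ?_, ?_⟩ <;> refine Metric.tendstoUniformlyOn_iff.2 fun ε hε => ?_ <;>
    filter_upwards [key ε hε] with n hn p hp
  · rw [dist_comm, dist_eq_norm]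
    exact (le_max_left _ _).trans_lt ((le_max_left _ _).trans_lt (hn p hp η₀))
  · rw [dist_comm, dist_eq_norm]
    exact (le_max_right _ _).trans_lt ((le_max_left _ _).trans_lt (hn p hp η₀))
  · rw [dist_comm, Real.dist_eq]
    exact (le_max_left _ _).trans_lt ((le_max_right _ _).trans_lt (hn p.1 hp.1 p.2))
  · rw [dist_comm, Real.dist_eq]
    exact (le_max_right _ _).trans_lt ((le_max_right _ _).trans_lt (hn p.1 hp.1 p.2))
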